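/- Let $\mathcal I$ be a finite set of customer types and $\bar{\mathcal K}\subset\mathbb Z_+^{\mathcal I}$ a finite set of server configurations that is monotone ($k\in\bar{\mathcal K}$ and $k'\in\mathbb Z_+^{\mathcal I}$, $k'\le k$ componentwise, imply $k'\in\bar{\mathcal K}$) and contains every unit vector $e_i$. Let $\lambda_i,\mu_i>0$ ($i\in\mathcal I$), $\mu_0>0$, $p\in(1/2,1)$, put $\rho_i=\lambda_i/\mu_i$, and assume $\sum_i\rho_i=1$. **The open system with parameter $r>0$ under GSS-M.** There are infinitely many servers, each of which holds actual customers and tokens; a server with $k_i$ customers and tokens of type $i$ (together), of which $\hat k_i$ are actual customers, has complete configuration $(k,\hat k)$, where $\hat k\le k\in\bar{\mathcal K}$. The state is the vector of the numbers $X_{(k,\hat k)}$ of servers with complete configuration $(k,\hat k)$, $k\neq0$. Let $X_k=\sum_{\hat k}X_{(k,\hat k)}$ for $k\ne 0$, $X_0=0$; let $\hat Y_i$ and $\tilde Y_i$ be the numbers of actual customers and of tokens of type $i$, let $Z=\sum_i\hat Y_i$, and let $w(X)=\min\{1,X/Z^p\}$ (for $Z=0$: $w(0)=0$ and $w(X)=1$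 for $X>0$). Placing a type-$i$ customer or token *by GSS* means adding it to a server of configuration $k$, where $k+e_i\in\bar{\mathcal K}$ and ($k=0$ or $X_k>0$), such that $w(X_{k+e_i})-w(X_k)$ is minimal, with all quantities evaluated in the current state and ties broken arbitrarily. Type-$i$ customers arrive according to independent Poisson processes of rates $\lambda_i r$; each replaces an existing type-$i$ token (chosen arbitrarily) if there is one, and otherwise is placed by GSS. Each actual type-$i$ customer completes service at rate $\mu_i$ and leaves; a type-$i$ token is then immediately created and placed by GSS. Each token that is not replaced leaves after an independent exponential time with mean $1/\mu_0$. The arbitrary choices are made by a (possibly randomized, possibly $r$-dependent) Markovian rule, so that the state process is a continuous-time Markov chain. **Theorem.** Consider a sequence of values $r\to\infty$ of the parameter and, for each $r$ in it, the above Markov chain in stationary regime (on any probability space). Let $\hat Y_i^r(t),\tilde Y_i^r(t),Z^r(t)$ be the corresponding values of $\hat Y_i,\tilde Y_i,Z$ at time $t$, and let $\|\cdot\|$ be the $1$-norm on $\mathbb R^2$. Then for all $q>1/2$ and $T>0$, as $r\to\infty$, $$\sup_{t\in[0,Tr^{1-q}]} r^{-q}\bigl\|(\hat Y_i^r(t)-\rho_i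 r,\ \tilde Y_i^r(t))\bigr\|\Longrightarrow 0\quad\text{for every } i\in\mathcal I,$$ and, consequently, $$\sup_{t\in[0,Tr^{1-q}]} r^{-q}\,|Z^r(t)-r|\Longrightarrow 0,$$ where $\Longrightarrow$ denotes convergence in distribution and the suprema are finite random variables. -/

import Mathlib

open Filter Topology MeasureTheory ProbabilityTheory
open scoped NNReal

noncomputable section

namespace PackingSystem

/-- A complete server configuration `(k, k̂)`: `k i` customers of type `i` in the server, actual
customers and tokens together, of which `k̂ i` are actual customers. The pair `(0, 0)` stands for an
empty server. -/
abbrev CompleteConfig (ι : Type*) : Type _ := (ι → ℕ) × (ι → ℕ)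

variable {ι : Type*} [Fintype ι] [DecidableEq ι]

/-- The `i`-th standard unit vector. -/
def unitVec (i : ι) : ι → ℕ := Pi.single i 1

open Classical in
/-- The complete configurations `(k, k̂)` of non-empty servers: `k ∈ K̄ \ {0}`, `k̂ ∈ K̄`, `k̂ ≤ k`. -/
def completeConfigs (K : Finset (ι → ℕ)) : Finset (CompleteConfig ι) :=
  (K ×ˢ K).filter fun c => c.1 ≠ 0 ∧ c.2 ≤ c.1

/-- A system state: the number of servers in each non-empty complete configuration. -/
abbrev State (K : Finset (ι → ℕ)) : Type _ := {c // c ∈ completeConfigs K} → ℕ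

variable {K : Finset (ι → ℕ)}

/-- The number of servers in the complete configuration `c`; empty servers are not counted. -/
def numServers (x : State K) (c : CompleteConfig ι) : ℕ :=
  if h : c ∈ completeConfigs K then x ⟨c, h⟩ else 0

/-- `X_k = ∑_{k̂ ≤ k} X_{(k, k̂)}`, with `X_0 = 0`. -/
def numWithConfig (x : State K) (k : ι → ℕ) : ℕ :=
  ∑ c : {c // c ∈ completeConfigs K}, if c.1.1 = k then x c else 0

/-- `Ŷ_i`: the number of actual customers of type `i`. -/
def numActual (x : State K) (i : ι) : ℕ :=
  ∑ c : {c // c ∈ completeConfigs K}, c.1.2 i * x c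

/-- `Ỹ_i`: the number of tokens of type `i`. -/
def numTokens (x : State K) (i : ι) : ℕ :=
  ∑ c : {c // c ∈ completeConfigs K}, (c.1.1 i - c.1.2 i) * x c

/-- `Z = ∑_i Ŷ_i`: the total number of actual customers. -/
def totalActual (x : State K) : ℕ := ∑ i, numActual x i

/-- The state that consists of one server in configuration `c`
(the zero state if the server is empty). -/
def oneServer (c : CompleteConfig ι) : State K := fun d => if d.1 = c then 1 else 0

/-- The state after one server has changed its complete configuration from `c` to `c'`. -/
def moveServer (c c' : CompleteConfig ι) (x : State K) : State K :=
  x - oneServer c + oneServer c'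

/-- The weight `1 ∧ X / Z ^ p`. For `Z = 0` the limiting value as `Z ↓ 0` is used: `0` if `X = 0`,
and `1` if `X > 0`. -/
def weight (p : ℝ) (Z X : ℕ) : ℝ :=
  if Z = 0 then (if X = 0 then 0 else 1) else min 1 ((X : ℝ) / (Z : ℝ) ^ p)

/-- The weight difference `w(X_{k + e_i}) - w(X_k)` of placing a type-`i` customer or token into a
server with configuration `k`. -/
def weightDiff (p : ℝ) (x : State K) (i : ι) (k : ι → ℕ) : ℝ :=
  weight p (totalActual x) (numWithConfig x (k + unitVec i)) -
    weight p (totalActual x) (numWithConfig x k)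

/-- A type-`i` customer or token fits into some server with configuration `k` in state `x`: either
`k = 0` or `X_k > 0`, and `k + e_i` is a server configuration. -/
def CanPlace (x : State K) (i : ι) (k : ι → ℕ) : Prop :=
  (k = 0 ∨ 0 < numWithConfig x k) ∧ k + unitVec i ∈ K

open Classical in
/-- The servers, described by their complete configurations, into which the GSS rule may place a
type-`i` customer or token in state `x`: an empty server, or an existing one, where the weight
difference is minimal. -/
def gssChoices (p : ℝ) (x : State K) (i : ι) : Finset (CompleteConfig ι) :=
  (insert (0, 0) (completeConfigs K)).filter fun c =>
    (c = (0, 0) ∨ 0 < numServers x c) ∧ CanPlace x i c.1 ∧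
      ∀ k, CanPlace x i k → weightDiff p x i c.1 ≤ weightDiff p x i k

/-- The complete configurations of the existing servers that hold a token of type `i`. -/
def tokenServers (x : State K) (i : ι) : Finset (CompleteConfig ι) :=
  (completeConfigs K).filter fun c => 0 < numServers x c ∧ c.2 i < c.1 i

/-- `w` is a probability distribution on the finite set `s`. -/
def IsDistributionOn {α : Type*} (w : α → ℝ) (s : Finset α) : Prop :=
  (∀ c, 0 ≤ w c) ∧ (∀ c, c ∉ s → w c = 0) ∧ ∑ c ∈ s, w c = 1

variable (K) in
/-- A Markovian (possibly randomized) way to make the choices that the GSS-M policy leaves open. -/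
structure TieBreaking (p : ℝ) where
  /-- the distribution of the server whose token of type `i` an arriving customer replaces -/
  replace : ι → State K → CompleteConfig ι → ℝ
  /-- the distribution of the server in which an arriving type-`i` customer is placed -/
  placeCustomer : ι → State K → CompleteConfig ι → ℝ
  /-- `placeToken i c x`: the distribution of the server in which a new type-`i` token is placed,
  when the service completion happened in a server with complete configuration `c` and left the
  system in state `x` -/
  placeToken : ι → CompleteConfig ι → State K → CompleteConfig ι → ℝ
  replace_spec : ∀ i x, (tokenServers x i).Nonempty →
    IsDistributionOn (replace i x) (tokenServers x i)
  placeCustomer_spec : ∀ i x, IsDistributionOn (placeCustomer i x) (gssChoices p x i)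
  placeToken_spec : ∀ i c x, IsDistributionOn (placeToken i c x) (gssChoices p x i)

/-- The expected change of `f` when a type-`i` customer arrives in state `x`. It replaces a token of
type `i` if there is one, and is placed by GSS otherwise. -/
def arrivalChange {p : ℝ} (τ : TieBreaking K p) (f : State K → ℝ) (x : State K) (i : ι) : ℝ :=
  if (tokenServers x i).Nonempty then
    ∑ c ∈ tokenServers x i, τ.replace i x c *
      (f (moveServer c (c.1, c.2 + unitVec i) x) - f x)
  else
    ∑ c ∈ gssChoices p x i, τ.placeCustomer i x c *
      (f (moveServer c (c.1 + unitVec i, c.2 + unitVec i) x) - f x)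

/-- The state just after an actual type-`i` customer has left a server in configuration `c`. -/
def afterService (c : CompleteConfig ι) (i : ι) (x : State K) : State K :=
  moveServer c (c.1 - unitVec i, c.2 - unitVec i) x

/-- The expected change of `f` when a type-`i` service is completed in a server in configuration
`c`: the customer leaves, and a token of type `i` is immediately placed by GSS. -/
def serviceChange {p : ℝ} (τ : TieBreaking K p) (f : State K → ℝ) (x : State K) (i : ι)
    (c : CompleteConfig ι) : ℝ :=
  ∑ d ∈ gssChoices p (afterService c i x) i, τ.placeToken i c (afterService c i x) d *
    (f (moveServer d (d.1 + unitVec i, d.2) (afterService c i x)) - f x)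

/-- The change of `f` when a type-`i` token of a server in configuration `c` times out. -/
def timeoutChange (f : State K → ℝ) (x : State K) (i : ι) (c : CompleteConfig ι) : ℝ :=
  f (moveServer c (c.1 - unitVec i, c.2) x) - f x

/-- The generator of the Markov chain of complete system states of the open system with scaling
parameter `r` under GSS-M: type-`i` customers arrive at rate `lam i * r`, every actual type-`i`
customer completes service at rate `mu i`, and every token times out at rate `mu0`. -/
def generator (lam mu : ι → ℝ) (mu0 r : ℝ) {p : ℝ} (τ : TieBreaking K p)
    (f : State K → ℝ) (x : State K) : ℝ :=
  ∑ i, lam i * r * arrivalChange τ f x i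
    + ∑ i, ∑ c : {c // c ∈ completeConfigs K},
        mu i * (c.1.2 i * x c : ℕ) * serviceChange τ f x i c.1
    + ∑ i, ∑ c : {c // c ∈ completeConfigs K},
        mu0 * ((c.1.1 i - c.1.2 i) * x c : ℕ) * timeoutChange f x i c.1

/-- `X` is a continuous-time Markov chain with generator `A` on the countable discrete state space
`S`, relative to the filtration `ℱ`: it is adapted, has right-continuous piecewise constant paths
with finitely many jumps in bounded time, and solves the martingale problem for `A`. -/
structure IsMarkovChain {S : Type*} [MeasurableSpace S] (A : (S → ℝ) → S → ℝ)
    {Ω : Type*} {mΩ : MeasurableSpace Ω} (P : Measure Ω) (ℱ : Filtration ℝ≥0 mΩ)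
    (X : ℝ≥0 → Ω → S) : Prop where
  adapted : ∀ t, Measurable[ℱ t] (X t)
  right_continuous : ∀ ω t, ∀ᶠ s in 𝓝[>] t, X s ω = X t ω
  left_limits : ∀ ω t, ∃ y, ∀ᶠ s in 𝓝[<] t, X s ω = y
  martingale : ∀ f : S → ℝ, f.support.Finite →
    Martingale (fun (t : ℝ≥0) ω => f (X t ω) - ∫ s in (0 : ℝ)..t, A f (X s.toNNReal ω)) ℱ P

/-- All one-dimensional marginal laws of `X` coincide
(for a Markov chain this says that it is stationary). -/
def IsStationaryProcess {S : Type*} [MeasurableSpace S] {Ω : Type*} [MeasurableSpace Ω]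
    (P : Measure Ω) (X : ℝ≥0 → Ω → S) : Prop :=
  ∀ t, P.map (X t) = P.map (X 0)

/-- `r ^ (-q) ‖(Ŷ_i - ρ r, Ỹ_i)‖` in state `x`, with the `1`-norm on the plane. -/
def typeDeviation (r q ρ : ℝ) (i : ι) (x : State K) : ℝ :=
  r ^ (-q) * (|(numActual x i : ℝ) - ρ * r| + |(numTokens x i : ℝ)|)

/-- `r ^ (-q) |Z - r|` in state `x`. -/
def totalDeviation (r q : ℝ) (x : State K) : ℝ :=
  r ^ (-q) * |(totalActual x : ℝ) - r|

/-- The values of a real function of time on the interval `[0, a]`. -/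
def valuesUpTo (g : ℝ≥0 → ℝ) (a : ℝ) : Set ℝ := g '' {t | (t : ℝ) ≤ a}

end PackingSystem

end

open PackingSystem

/-! The packing rule does not affect the counts. Wherever customers and tokens sit, a type-`i`
arrival adds a customer and deletes a type-`i` token if there is one, a service turns a customer
into a token, and a timeout deletes a token. So (Ŷ, Ỹ) evolves autonomously (`generator_counts`),
and its generator splits over types (`countGenerator_sum`): Ŷ_i behaves like an M/M/∞ queue centred
at ρ_i r with fluctuations of order √r, while Ỹ_i is driven by μ_i Ŷ_i − λ_i r and pulled back by
−μ0 Ỹ_i.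

For each even M ≥ 2, V = ∑ (κ_i (Ŷ_i − ρ_i r)^M + Ỹ_i^M) satisfies AV ≤ C r^{M/2} − cV with κ, c, C
independent of r (`exists_typeGenerator_le`, `exists_isLyapunov`). To first order both components
contract, and a large κ_i absorbs the influence of Ŷ_i on Ỹ_i. The second-order jump noise is of
order r times a power M − 2, which Young's inequality turns into r^{M/2} plus a small multiple of V.

In stationarity this drift bounds the mean of V by C r^{M/2} / c, and an optional-stopping argument
bounds P(sup_{s ≤ t} V ≥ a) by C r^{M/2} (1/c + t) / a (`IsLyapunov.measure_exists_le`). Taking a =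
(δ r^q)^M and t = T r^{1−q} leaves terms of order r^{−M(q−1/2)} and r^{1−q−M(q−1/2)}. Both vanish
once M is large, because q > 1/2; for q near 1/2 a high power is essential. The martingale problem
only covers finitely supported test functions, so V enters through truncations. -/

namespace PackingSystem

/-! ### Piecewise constant paths and dyadic times -/

section Paths

variable {S : Type*}

/-- Grid times strictly to the right of `s` converge to `s`, and the path is constant just after
`s`, so it is a pointwise limit of functions factoring through ℕ. -/
lemma measurable_path {Y : ℝ≥0 → S} (hY : ∀ t, ∀ᶠ s in 𝓝[>] t, Y s = Y t) (g : S → ℝ) :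
    Measurable fun s : ℝ => g (Y s.toNNReal) := by
  have h : Measurable fun s : ℝ≥0 => g (Y s) := by
    let u : ℕ → ℝ≥0 → ℝ≥0 := fun n s => ((⌊(n + 1 : ℝ≥0) * s⌋₊ : ℝ≥0) + 1) / (n + 1)
    have hu : ∀ n, Measurable fun s => g (Y (u n s)) := fun n =>
      (measurable_from_nat (f := fun m : ℕ => g (Y (((m : ℝ≥0) + 1) / (n + 1))))).comp
        (Nat.measurable_floor.comp (measurable_const.mul measurable_id))
    refine measurable_of_tendsto_metrizable hu (tendsto_pi_nhds.2 fun s => ?_)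
    have hgt : ∀ n, s < u n s := fun n => by
      rw [lt_div_iff₀ (by positivity), mul_comm]
      exact Nat.lt_floor_add_one _
    have hle : ∀ n, u n s ≤ s + 1 / (n + 1) := fun n => by
      have h0 : ((n : ℝ≥0) + 1) ≠ 0 := by positivity
      have h1 : s + 1 / ((n : ℝ≥0) + 1) = ((n + 1 : ℝ≥0) * s + 1) / (n + 1) := by field_simp
      rw [h1]
      exact div_le_div_of_nonneg_right (add_le_add_left (Nat.floor_le (by positivity)) 1)
        (by positivity)
    have hlim : Tendsto (fun n => u n s) atTop (𝓝 s) := by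
      refine tendsto_of_tendsto_of_tendsto_of_le_of_le tendsto_const_nhds ?_
        (fun n => (hgt n).le) hle
      simpa using tendsto_const_nhds.add (tendsto_one_div_add_atTop_nhds_zero_nat (𝕜 := ℝ≥0))
    have hlim' : Tendsto (fun n => u n s) atTop (𝓝[>] s) :=
      tendsto_nhdsWithin_iff.2 ⟨hlim, .of_forall hgt⟩
    refine tendsto_const_nhds.congr' ?_
    filter_upwards [hlim'.eventually (hY s)] with n hn
    rw [hn]
  exact h.comp measurable_real_toNNReal

/-- The value at `t < a` persists on an interval to the right of `t`, which contains a point of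
every fine enough dyadic grid; `t = a` is itself a grid point. This replaces all times by countably
many. -/
lemma exists_dyadic_eq {Y : ℝ≥0 → S} (hY : ∀ t, ∀ᶠ s in 𝓝[>] t, Y s = Y t) {a t : ℝ≥0}
    (ht : t ≤ a) : ∃ n k : ℕ, k ≤ 2 ^ n ∧ Y (k * (a / 2 ^ n)) = Y t := by
  rcases ht.eq_or_lt with rfl | hlt
  · exact ⟨0, 1, by simp, by simp⟩
  obtain ⟨b, hb, hbY⟩ := (mem_nhdsGT_iff_exists_Ioo_subset' hlt).1 (hY t)
  have hb' : t < min a b := lt_min hlt hb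
  have ha : 0 < a := lt_of_le_of_lt (zero_le (a := t)) hlt
  obtain ⟨n, hn⟩ : ∃ n : ℕ, a / 2 ^ n < min a b - t := by
    have : Tendsto (fun n : ℕ => a * (1 / 2 : ℝ≥0) ^ n) atTop (𝓝 (a * 0)) :=
      tendsto_const_nhds.mul (NNReal.tendsto_pow_atTop_nhds_zero_of_lt_one (by
        rw [← NNReal.coe_lt_coe]; norm_num))
    rw [mul_zero] at this
    obtain ⟨n, hn⟩ := (this.eventually (gt_mem_nhds (tsub_pos_of_lt hb'))).exists
    exact ⟨n, by simpa [div_eq_mul_inv] using hn⟩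
  have hδ : 0 < a / 2 ^ n := by positivity
  set δ := a / 2 ^ n with hδdef
  set k := ⌊t / δ⌋₊ + 1 with hk
  have h1 : t < k * δ := by
    rw [← div_lt_iff₀ hδ, hk]; push_cast; exact Nat.lt_floor_add_one _
  have h2 : k * δ < min a b := by
    calc (k : ℝ≥0) * δ = ⌊t / δ⌋₊ * δ + δ := by rw [hk]; push_cast; ring
      _ ≤ t + δ := by
        gcongr
        rw [← le_div_iff₀ hδ]
        exact Nat.floor_le (by positivity)
      _ < t + (min a b - t) := by gcongr
      _ = min a b := add_tsub_cancel_of_le hb'.le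
  refine ⟨n, k, ?_, hbY ⟨h1, h2.trans_le (min_le_right _ _)⟩⟩
  have h3 : (k : ℝ≥0) * δ ≤ 2 ^ n * δ := by
    refine (h2.trans_le (min_le_left _ _)).le.trans (le_of_eq ?_)
    rw [hδdef, mul_div_cancel₀]; positivity
  exact_mod_cast le_of_mul_le_mul_right h3 hδ

/-- Compactness: near each time the path takes at most two values, its left limit and its current
value. -/
lemma finite_image_path {Y : ℝ≥0 → S} (hY : ∀ t, ∀ᶠ s in 𝓝[>] t, Y s = Y t)
    (hl : ∀ t, ∃ y, ∀ᶠ s in 𝓝[<] t, Y s = y) (a : ℝ≥0) : (Y '' Set.Iic a).Finite := by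
  have hc : IsCompact (Set.Iic a) := by
    rw [← Set.Icc_bot]; exact isCompact_Icc
  refine hc.induction_on (p := fun s => (Y '' s).Finite) (by simp)
    (fun s t hst ht => ht.subset (Set.image_mono hst))
    (fun s t hs ht => by rw [Set.image_union]; exact hs.union ht) fun t _ => ?_
  obtain ⟨y, hy⟩ := hl t
  refine ⟨{s | Y s = y ∨ Y s = Y t}, mem_nhdsWithin_of_mem_nhds ?_, ?_⟩
  · rw [← nhdsLT_sup_nhdsGE t, ← Set.Ioi_insert, nhdsWithin_insert]
    refine ⟨?_, ?_, ?_⟩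
    · filter_upwards [hy] with s hs using Or.inl hs
    · simp
    · filter_upwards [hY t] with s hs using Or.inr hs
  · refine (Set.toFinite {y, Y t}).subset ?_
    rintro _ ⟨s, hs, rfl⟩
    exact hs

lemma setOf_exists_eq_iUnion_dyadic {Ω : Type*} {X : ℝ≥0 → Ω → S}
    (hX : ∀ ω t, ∀ᶠ s in 𝓝[>] t, X s ω = X t ω) (a : ℝ≥0) (p : S → Prop) :
    {ω | ∃ t ≤ a, p (X t ω)} = ⋃ n : ℕ, {ω | ∃ k : ℕ, k ≤ 2 ^ n ∧ p (X (k * (a / 2 ^ n)) ω)} := by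
  ext ω
  simp only [Set.mem_ofPred_eq, Set.mem_iUnion]
  constructor
  · rintro ⟨t, ht, hp⟩
    obtain ⟨n, k, hk, e⟩ := exists_dyadic_eq (hX ω) ht
    exact ⟨n, k, hk, by rwa [e]⟩
  · rintro ⟨n, k, hk, hp⟩
    refine ⟨_, ?_, hp⟩
    calc (k : ℝ≥0) * (a / 2 ^ n) ≤ 2 ^ n * (a / 2 ^ n) := by
          have : (k : ℝ≥0) ≤ 2 ^ n := by exact_mod_cast hk
          gcongr
      _ = a := by rw [mul_div_cancel₀]; positivity

lemma valuesUpTo_eq_range {Y : ℝ≥0 → S} (hY : ∀ t, ∀ᶠ s in 𝓝[>] t, Y s = Y t) (g : S → ℝ)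
    (a : ℝ≥0) : valuesUpTo (fun t => g (Y t)) a =
      Set.range fun d : Σ n : ℕ, Fin (2 ^ n + 1) => g (Y ((d.2 : ℕ) * (a / 2 ^ d.1))) := by
  ext v
  simp only [valuesUpTo, Set.mem_image, Set.mem_ofPred_eq, Set.mem_range, NNReal.coe_le_coe]
  constructor
  · rintro ⟨t, ht, rfl⟩
    obtain ⟨n, k, hk, e⟩ := exists_dyadic_eq hY ht
    exact ⟨⟨n, k, Nat.lt_succ_of_le hk⟩, by simp only [e]⟩
  · rintro ⟨⟨n, k, hk⟩, rfl⟩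
    refine ⟨_, ?_, rfl⟩
    calc (k : ℝ≥0) * (a / 2 ^ n) ≤ 2 ^ n * (a / 2 ^ n) := by
          have : (k : ℝ≥0) ≤ 2 ^ n := by exact_mod_cast Nat.le_of_lt_succ hk
          gcongr
      _ = a := by rw [mul_div_cancel₀]; positivity

lemma exists_bound_of_finite_support {f : S → ℝ} (hf : f.support.Finite) : ∃ B, ∀ x, |f x| ≤ B := by
  obtain ⟨B, hB⟩ := (hf.image fun x => |f x|).bddAbove
  refine ⟨max B 0, fun x => ?_⟩
  by_cases hx : f x = 0
  · simp [hx]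
  · exact (hB ⟨x, hx, rfl⟩).trans (le_max_left _ _)

end Paths

/-! ### Consequences of the martingale problem -/

section Chain

variable {S : Type*} [MeasurableSpace S] {A : (S → ℝ) → S → ℝ}
  {Ω : Type*} {mΩ : MeasurableSpace Ω} {P : Measure Ω} {ℱ : Filtration ℝ≥0 mΩ} {X : ℝ≥0 → Ω → S}

lemma IsMarkovChain.measurable (h : IsMarkovChain A P ℱ X) (t : ℝ≥0) : Measurable (X t) :=
  (h.adapted t).mono (ℱ.le t) le_rfl

lemma IsMarkovChain.intervalIntegrable (h : IsMarkovChain A P ℱ X) {g : S → ℝ} {B : ℝ}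
    (hg : ∀ x, |g x| ≤ B) (ω : Ω) (s t : ℝ) :
    IntervalIntegrable (fun u : ℝ => g (X u.toNNReal ω)) volume s t := by
  rw [intervalIntegrable_iff]
  exact Measure.integrableOn_of_bounded (M := B) (by simp)
    (measurable_path (h.right_continuous ω) g).aestronglyMeasurable (.of_forall fun u => hg _)

variable [DiscreteMeasurableSpace S] [IsProbabilityMeasure P]

lemma IsMarkovChain.integrable_comp (h : IsMarkovChain A P ℱ X) {g : S → ℝ} {B : ℝ}
    (hg : ∀ x, |g x| ≤ B) (t : ℝ≥0) : Integrable (fun ω => g (X t ω)) P :=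
  Integrable.of_bound ((Measurable.of_discrete (f := g)).comp (h.measurable t)).aestronglyMeasurable
    B (.of_forall fun _ => hg _)

/-- Along a Markov chain, the conditional mean of `f` grows at most at rate `C` if `A f ≤ C`. -/
lemma IsMarkovChain.setIntegral_le (h : IsMarkovChain A P ℱ X) {f : S → ℝ}
    (hf : f.support.Finite) {B C : ℝ} (hB : ∀ x, |A f x| ≤ B) (hC : ∀ x, A f x ≤ C)
    {s t : ℝ≥0} (hst : s ≤ t) {E : Set Ω} (hE : MeasurableSet[ℱ s] E) :
    ∫ ω in E, f (X t ω) ∂P ≤ ∫ ω in E, f (X s ω) ∂P + C * (t - s) * P.real E := by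
  obtain ⟨Bf, hBf⟩ := exists_bound_of_finite_support hf
  have hM := h.martingale f hf
  have h1 := hM.setIntegral_eq hst hE
  have hfi := fun u => h.integrable_comp hBf u
  -- Integrability comes from writing the time integral as `f` minus the martingale, so no joint
  -- measurability in time and `ω` is needed.
  have hJ : ∀ u : ℝ≥0, Integrable (fun ω => ∫ v in (0 : ℝ)..u, A f (X v.toNNReal ω)) P := fun u => by
    have := (hfi u).sub (hM.integrable u)
    refine this.congr (.of_forall fun ω => ?_)
    simp
  rw [integral_sub (hfi s).integrableOn (hJ s).integrableOn,
    integral_sub (hfi t).integrableOn (hJ t).integrableOn] at h1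
  have h2 : ∫ ω in E, (∫ v in (0 : ℝ)..t, A f (X v.toNNReal ω)) ∂P ≤
      ∫ ω in E, ((∫ v in (0 : ℝ)..s, A f (X v.toNNReal ω)) + C * (t - s)) ∂P := by
    refine setIntegral_mono (hJ t).integrableOn ((hJ s).add (integrable_const _)).integrableOn
      fun ω => ?_
    have hi := fun a b => h.intervalIntegrable hB ω a b
    simp only
    rw [← intervalIntegral.integral_add_adjacent_intervals (hi 0 s) (hi s t)]
    gcongr
    have := intervalIntegral.integral_mono_on (μ := volume) (NNReal.coe_le_coe.2 hst) (hi s t)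
      intervalIntegrable_const fun v _ => hC (X v.toNNReal ω)
    simpa [mul_comm] using this
  rw [integral_add (hJ s).integrableOn (integrable_const _), setIntegral_const, smul_eq_mul,
    mul_comm (P.real E)] at h2
  linarith

/-- The stationary law annihilates the generator. -/
lemma IsMarkovChain.integral_generator_eq_zero (h : IsMarkovChain A P ℱ X)
    (hs : IsStationaryProcess P X) {f : S → ℝ} (hf : f.support.Finite) {B : ℝ}
    (hB : ∀ x, |A f x| ≤ B) : ∫ ω, A f (X 0 ω) ∂P = 0 := by
  obtain ⟨Bf, hBf⟩ := exists_bound_of_finite_support hf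
  have hM := h.martingale f hf
  have hfi := fun u => h.integrable_comp hBf u
  have hJ : ∀ u : ℝ≥0, Integrable (fun ω => ∫ v in (0 : ℝ)..u, A f (X v.toNNReal ω)) P := fun u => by
    have := (hfi u).sub (hM.integrable u)
    refine this.congr (.of_forall fun ω => ?_)
    simp
  have hJ0 : ∀ u : ℝ≥0, ∫ ω, (∫ v in (0 : ℝ)..u, A f (X v.toNNReal ω)) ∂P = 0 := fun u => by
    have h1 := hM.setIntegral_eq (zero_le (a := u)) MeasurableSet.univ
    simp only [setIntegral_univ] at h1
    rw [integral_sub (hfi 0) (hJ 0), integral_sub (hfi u) (hJ u)] at h1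
    have h2 : ∀ u, ∫ ω, f (X u ω) ∂P = ∫ x, f x ∂(P.map (X u)) := fun u =>
      (integral_map (h.measurable u).aemeasurable
        (Measurable.of_discrete (f := f)).aestronglyMeasurable).symm
    rw [h2 u, hs u, ← h2 0] at h1
    simp at h1
    linarith
  -- The time integral of `A f` has mean zero over every window `[0, u]`. Averaging over windows
  -- shrinking to 0 recovers `A f (X 0)`, as the path is constant just after 0; no Fubini is needed.
  let δ : ℕ → ℝ≥0 := fun n => 1 / (n + 1)
  have hδ : ∀ n, 0 < δ n := fun n => by positivity
  have hlim : Tendsto (fun n => ∫ ω, (δ n : ℝ)⁻¹ * (∫ v in (0 : ℝ)..δ n, A f (X v.toNNReal ω)) ∂P)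
      atTop (𝓝 (∫ ω, A f (X 0 ω) ∂P)) := by
    refine tendsto_integral_of_dominated_convergence (fun _ => B)
      (fun n => ((hJ _).const_mul _).aestronglyMeasurable) (integrable_const _)
      (fun n => .of_forall fun ω => ?_) (.of_forall fun ω => ?_)
    · have := intervalIntegral.norm_integral_le_of_norm_le_const (a := 0) (b := (δ n : ℝ))
        (f := fun v => A f (X v.toNNReal ω)) (C := B) fun v _ => hB _
      have hp : (0 : ℝ) < δ n := hδ n
      rw [norm_mul, norm_inv, Real.norm_of_nonneg hp.le, inv_mul_le_iff₀ hp, mul_comm]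
      simpa [abs_of_pos hp] using this
    · obtain ⟨b, hb, hbY⟩ := (mem_nhdsGT_iff_exists_Ioo_subset' (zero_lt_one (α := ℝ≥0))).1
        (h.right_continuous ω 0)
      have hδ0 : Tendsto δ atTop (𝓝 0) := tendsto_one_div_add_atTop_nhds_zero_nat
      refine tendsto_const_nhds.congr' ?_
      filter_upwards [hδ0.eventually (gt_mem_nhds hb)] with n hn
      have hp : (0 : ℝ) < δ n := hδ n
      have : ∫ v in (0 : ℝ)..δ n, A f (X v.toNNReal ω) = ∫ v in (0 : ℝ)..δ n, A f (X 0 ω) := by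
        refine intervalIntegral.integral_congr_ae (.of_forall fun v hv => ?_)
        rw [Set.uIoc_of_le hp.le] at hv
        have : X v.toNNReal ω = X 0 ω := hbY ⟨by simpa using hv.1, by
          refine lt_of_le_of_lt ?_ hn
          rw [Real.toNNReal_le_iff_le_coe]; exact hv.2⟩
        simp only [this]
      rw [this]
      simp [hp.ne']
  refine tendsto_nhds_unique hlim ?_
  simp_rw [integral_const_mul, hJ0, mul_zero]
  exact tendsto_const_nhds

end Chain

/-! ### Drift condition and maximal inequality -/

section Lyapunov

variable {S : Type*}

/-- `V` is a non-negative function with finite sublevel sets such that, for all truncation levels,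
the generator `A` satisfies the drift condition `A V ≤ C - c V`. The constant `a` is subtracted
from the truncation `min V a` in order to make it finitely supported. -/
structure IsLyapunov (A : (S → ℝ) → S → ℝ) (V : S → ℝ) (c C : ℝ) : Prop where
  nonneg : ∀ x, 0 ≤ V x
  finite_sublevel : ∀ a, {x | V x < a}.Finite
  bounded : ∀ a, ∃ B, ∀ x, |A (fun y => min (V y) a - a) x| ≤ B
  drift_of_lt : ∀ a x, V x < a → A (fun y => min (V y) a - a) x ≤ C - c * V x
  drift_of_le : ∀ a x, a ≤ V x → A (fun y => min (V y) a - a) x ≤ 0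

variable {A : (S → ℝ) → S → ℝ} {V : S → ℝ} {c C : ℝ}

lemma IsLyapunov.finite_support (hV : IsLyapunov A V c C) (a : ℝ) :
    (fun y => min (V y) a - a).support.Finite := by
  refine (hV.finite_sublevel a).subset fun x hx => ?_
  by_contra h
  have : a ≤ V x := not_lt.1 h
  exact hx (by simp [this])

lemma IsLyapunov.abs_min_le (hV : IsLyapunov A V c C) {a : ℝ} (ha : 0 ≤ a) (x : S) :
    |min (V x) a| ≤ a := by
  rw [abs_of_nonneg (le_min (hV.nonneg x) ha)]
  exact min_le_right _ _

variable [MeasurableSpace S] [DiscreteMeasurableSpace S]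
  {Ω : Type*} {mΩ : MeasurableSpace Ω} {P : Measure Ω} [IsProbabilityMeasure P]
  {ℱ : Filtration ℝ≥0 mΩ} {X : ℝ≥0 → Ω → S}

/-- The stationary mean of a Lyapunov function. -/
lemma IsLyapunov.integral_min_le (hV : IsLyapunov A V c C) (hc : 0 < c) (hC : 0 ≤ C)
    (h : IsMarkovChain A P ℱ X) (hs : IsStationaryProcess P X) {a : ℝ} (ha : 0 ≤ a) :
    ∫ ω, min (V (X 0 ω)) a ∂P ≤ C / c := by
  classical
  -- The drift at truncation level `n` controls `V` only where `V < n`; `g n` vanishes elsewhere,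
  -- and `n → ∞` with `a` fixed.
  let g : ℕ → S → ℝ := fun n x => if V x < n then min (V x) a else 0
  have hg : ∀ n x, |g n x| ≤ a := fun n x => by
    by_cases hx : V x < n
    · simpa [g, hx] using hV.abs_min_le ha x
    · simpa [g, hx] using ha
  have hlim : Tendsto (fun n => ∫ ω, g n (X 0 ω) ∂P) atTop (𝓝 (∫ ω, min (V (X 0 ω)) a ∂P)) := by
    refine tendsto_integral_of_dominated_convergence (fun _ => a)
      (fun n => (h.integrable_comp (hg n) 0).aestronglyMeasurable) (integrable_const _)
      (fun n => .of_forall fun ω => hg n _) (.of_forall fun ω => ?_)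
    refine tendsto_const_nhds.congr' ?_
    filter_upwards [(tendsto_natCast_atTop_atTop (R := ℝ)).eventually_gt_atTop (V (X 0 ω))] with n hn
    simp [g, hn]
  refine le_of_tendsto hlim (.of_forall fun n => ?_)
  obtain ⟨B, hB⟩ := hV.bounded n
  have h0 := h.integral_generator_eq_zero hs (hV.finite_support n) hB
  have h1 : ∫ ω, A (fun y => min (V y) n - n) (X 0 ω) ∂P ≤ ∫ ω, (C - c * g n (X 0 ω)) ∂P := by
    refine integral_mono (h.integrable_comp hB 0)
      ((integrable_const _).sub ((h.integrable_comp (hg n) 0).const_mul c)) fun ω => ?_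
    by_cases hx : V (X 0 ω) < n
    · refine (hV.drift_of_lt _ _ hx).trans ?_
      simp only [g, hx, if_true]
      gcongr
      exact min_le_left _ _
    · refine (hV.drift_of_le _ _ (not_lt.1 hx)).trans ?_
      simpa [g, hx] using hC
  rw [h0, integral_sub (integrable_const _) ((h.integrable_comp (hg n) 0).const_mul c),
    integral_const_mul] at h1
  simp only [integral_const, probReal_univ, smul_eq_mul, one_mul] at h1
  rw [le_div_iff₀ hc]
  linarith

/-- Doob's maximal argument on a time grid: `min V a` is stopped when it first reaches `a`, and its
mean grows by at most `C * δ` per step from a stationary mean of at most `C / c`. -/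
lemma IsLyapunov.real_exists_le_nat (hV : IsLyapunov A V c C) (hc : 0 < c) (hC : 0 ≤ C)
    (h : IsMarkovChain A P ℱ X) (hs : IsStationaryProcess P X) {a : ℝ} (ha : 0 ≤ a) (δ : ℝ≥0)
    (N : ℕ) :
    a * P.real {ω | ∃ k : ℕ, k ≤ N ∧ a ≤ V (X (k * δ) ω)} ≤ C / c + C * (N * δ) := by
  let g : ℕ → Ω → ℝ := fun k ω => min (V (X (k * δ) ω)) a
  let E : ℕ → Set Ω := fun k => {ω | ∀ j ≤ k, V (X (j * δ) ω) < a}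
  have hg : ∀ k, Integrable (g k) P := fun k => h.integrable_comp (hV.abs_min_le ha) _
  have hE : ∀ k : ℕ, MeasurableSet[ℱ (k * δ)] (E k) := fun k => by
    have : E k = ⋂ j ≤ k, X (j * δ) ⁻¹' {x | V x < a} := by ext; simp [E]
    rw [this]
    refine MeasurableSet.iInter fun j => MeasurableSet.iInter fun hj => ?_
    have : ((j : ℝ≥0) * δ) ≤ k * δ := by
      have : (j : ℝ≥0) ≤ k := by exact_mod_cast hj
      gcongr
    exact ℱ.mono this _ (h.adapted _ (MeasurableSet.of_discrete))
  have hE' : ∀ k, MeasurableSet (E k) := fun k => ℱ.le _ _ (hE k)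
  have hsub : ∀ k, E (k + 1) ⊆ E k := fun k ω hω j hj => hω j (hj.trans k.le_succ)
  have hCA : ∀ x, A (fun y => min (V y) a - a) x ≤ C := fun x => by
    by_cases hx : V x < a
    · have := hV.drift_of_lt a x hx
      have := mul_nonneg hc.le (hV.nonneg x)
      linarith
    · exact (hV.drift_of_le a x (not_lt.1 hx)).trans hC
  obtain ⟨B, hB⟩ := hV.bounded a
  have hstep : ∀ k, ∫ ω in E k, g (k + 1) ω ∂P ≤ ∫ ω in E k, g k ω ∂P + C * δ := fun k => by
    have hle : ((k : ℝ≥0) * δ) ≤ (k + 1 : ℕ) * δ := by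
      have : (k : ℝ≥0) ≤ (k + 1 : ℕ) := by exact_mod_cast k.le_succ
      gcongr
    have h1 := h.setIntegral_le (hV.finite_support a) hB hCA hle (hE k)
    rw [integral_sub (hg _).integrableOn (integrable_const _).integrableOn,
      integral_sub (hg _).integrableOn (integrable_const _).integrableOn] at h1
    have h2 : C * ((((k + 1 : ℕ) * δ : ℝ≥0) : ℝ) - ((k * δ : ℝ≥0) : ℝ)) * P.real (E k) ≤ C * δ := by
      have : (((k + 1 : ℕ) * δ : ℝ≥0) : ℝ) - ((k * δ : ℝ≥0) : ℝ) = δ := by push_cast; ring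
      rw [this]
      exact mul_le_of_le_one_right (by positivity) measureReal_le_one
    linarith
  -- The left side is the mean of the stopped process: `E k` is the event of not having reached `a`
  -- up to step `k`, and on its complement the stopped value is `a`.
  have hind : ∀ k : ℕ, ∫ ω in E k, g k ω ∂P + a * P.real (E k)ᶜ ≤ C / c + C * (k * δ) := fun k => by
    induction k with
    | zero =>
      have h1 : ∫ ω in (E 0)ᶜ, g 0 ω ∂P = a * P.real (E 0)ᶜ := by
        rw [setIntegral_congr_fun (g := fun _ => a) (hE' 0).compl, setIntegral_const, smul_eq_mul,
          mul_comm]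
        intro ω hω
        have : a ≤ V (X 0 ω) := by simpa [E] using hω
        simp [g, this]
      rw [← h1, integral_add_compl (hE' 0) (hg 0)]
      simpa [g] using hV.integral_min_le hc hC h hs ha
    | succ k ih =>
      have h1 : ∫ ω in E k \ E (k + 1), g (k + 1) ω ∂P = a * P.real (E k \ E (k + 1)) := by
        rw [setIntegral_congr_fun (g := fun _ => a) ((hE' k).diff (hE' (k + 1))),
          setIntegral_const, smul_eq_mul, mul_comm]
        rintro ω ⟨hω, hω'⟩
        have : a ≤ V (X ((k + 1 : ℕ) * δ) ω) := by
          by_contra hlt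
          refine hω' fun j hj => ?_
          rcases Nat.le_succ_iff.1 hj with hj | rfl
          · exact hω j hj
          · exact not_le.1 hlt
        exact min_eq_right this
      have h2 := setIntegral_sdiff (hE' (k + 1)) (hg (k + 1)).integrableOn (hsub k) (μ := P)
      have h3 : P.real (E (k + 1))ᶜ = P.real (E k)ᶜ + P.real (E k \ E (k + 1)) := by
        rw [probReal_compl_eq_one_sub (hE' _), probReal_compl_eq_one_sub (hE' _),
          measureReal_sdiff (hsub k) (hE' _)]
        ring
      have h4 := hstep k
      rw [h3]
      push_cast
      nlinarith
  have hEN : {ω | ∃ k : ℕ, k ≤ N ∧ a ≤ V (X (k * δ) ω)} = (E N)ᶜ := by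
    ext ω; simp [E]
  have := hind N
  rw [hEN]
  have : 0 ≤ ∫ ω in E N, g N ω ∂P :=
    integral_nonneg fun ω => le_min (hV.nonneg _) ha
  linarith

/-- A maximal inequality for a Lyapunov function along a stationary Markov chain. -/
theorem IsLyapunov.measure_exists_le (hV : IsLyapunov A V c C) (hc : 0 < c) (hC : 0 ≤ C)
    (h : IsMarkovChain A P ℱ X) (hs : IsStationaryProcess P X) {a : ℝ} (ha : 0 < a) (t : ℝ≥0) :
    P {ω | ∃ s ≤ t, a ≤ V (X s ω)} ≤ ENNReal.ofReal ((C / c + C * t) / a) := by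
  rw [setOf_exists_eq_iUnion_dyadic h.right_continuous t fun x => a ≤ V x]
  rw [Monotone.measure_iUnion]
  · refine iSup_le fun n => ?_
    rw [← ofReal_measureReal]
    refine ENNReal.ofReal_le_ofReal ?_
    rw [le_div_iff₀' ha]
    refine (hV.real_exists_le_nat hc hC h hs ha.le (t / 2 ^ n) (2 ^ n)).trans (le_of_eq ?_)
    push_cast
    rw [mul_div_cancel₀ _ (by positivity)]
  -- The dyadic grids are nested: index `k` at level `n` is index `2 * k` at level `n + 1`.
  · refine monotone_nat_of_le_succ fun n => ?_
    rintro ω ⟨k, hk, hkV⟩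
    refine ⟨2 * k, by rw [pow_succ]; omega, ?_⟩
    convert hkV using 3
    push_cast
    rw [pow_succ]
    field_simp

end Lyapunov

/-! ### Finiteness and measurability of path suprema -/

section Supremum

variable {S : Type*}

lemma bddAbove_valuesUpTo {Y : ℝ≥0 → S} (hY : ∀ t, ∀ᶠ s in 𝓝[>] t, Y s = Y t)
    (hl : ∀ t, ∃ y, ∀ᶠ s in 𝓝[<] t, Y s = y) (g : S → ℝ) {a : ℝ} (ha : 0 ≤ a) :
    BddAbove (valuesUpTo (fun t => g (Y t)) a) := by
  refine (((finite_image_path hY hl ⟨a, ha⟩).image g).subset ?_).bddAbove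
  rintro _ ⟨t, ht, rfl⟩
  exact ⟨_, ⟨t, ht, rfl⟩, rfl⟩

variable [MeasurableSpace S] [DiscreteMeasurableSpace S] {A : (S → ℝ) → S → ℝ}
  {Ω : Type*} {mΩ : MeasurableSpace Ω} {P : Measure Ω} {ℱ : Filtration ℝ≥0 mΩ} {X : ℝ≥0 → Ω → S}

lemma IsMarkovChain.measurable_sSup_valuesUpTo (h : IsMarkovChain A P ℱ X) (g : S → ℝ) {a : ℝ}
    (ha : 0 ≤ a) : Measurable fun ω => sSup (valuesUpTo (fun t => g (X t ω)) a) := by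
  lift a to ℝ≥0 using ha
  simp_rw [valuesUpTo_eq_range (h.right_continuous _) g a]
  exact Measurable.iSup fun d => (Measurable.of_discrete (f := g)).comp (h.measurable _)

end Supremum

/-! ### Convergence in probability to zero gives convergence in law -/

section Distribution

/-- Portmanteau with open sets: the Dirac limit only charges those containing 0, and they contain a
ball around 0. -/
lemma tendstoInDistribution_zero {Ω : ℕ → Type*} {mΩ : ∀ n, MeasurableSpace (Ω n)}
    {P : ∀ n, Measure (Ω n)} [∀ n, IsProbabilityMeasure (P n)] {Y : ∀ n, Ω n → ℝ}
    (hm : ∀ n, Measurable (Y n))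
    (h : ∀ ε > 0, Tendsto (fun n => P n {ω | ε ≤ |Y n ω|}) atTop (𝓝 0)) :
    TendstoInDistribution Y atTop (fun _ : Unit => (0 : ℝ)) P (Measure.dirac ()) where
  forall_aemeasurable n := (hm n).aemeasurable
  tendsto := by
    refine tendsto_of_forall_isOpen_le_liminf' fun G hG => ?_
    simp only [ProbabilityMeasure.coe_mk, Measure.map_const, measure_univ, one_smul]
    by_cases h0 : (0 : ℝ) ∈ G
    · obtain ⟨ε, hε, hεG⟩ := Metric.isOpen_iff.1 hG 0 h0
      have h1 : Tendsto (fun n => 1 - P n {ω | ε ≤ |Y n ω|}) atTop (𝓝 (1 - 0)) :=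
        ENNReal.Tendsto.sub tendsto_const_nhds (h ε hε) (Or.inl (by simp))
      rw [Measure.dirac_apply_of_mem h0]
      rw [tsub_zero] at h1
      rw [← h1.liminf_eq]
      refine liminf_le_liminf (.of_forall fun n => ?_)
      rw [Measure.map_apply (hm n) hG.measurableSet, tsub_le_iff_right]
      calc 1 = P n Set.univ := measure_univ.symm
        _ ≤ P n (Y n ⁻¹' G ∪ {ω | ε ≤ |Y n ω|}) := by
          refine measure_mono fun ω _ => ?_
          by_cases hω : ε ≤ |Y n ω|
          · exact Or.inr hω
          · exact Or.inl (hεG (by simpa using hω))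
        _ ≤ _ := measure_union_le _ _
    · simp [hG.measurableSet, h0]

end Distribution

/-! ### Additive counts of a state -/

section Counting

variable {ι : Type*} [Fintype ι] {K : Finset (ι → ℕ)}

lemma mem_completeConfigs {c : CompleteConfig ι} :
    c ∈ completeConfigs K ↔ (c.1 ∈ K ∧ c.2 ∈ K) ∧ c.1 ≠ 0 ∧ c.2 ≤ c.1 := by
  simp [completeConfigs]

lemma eq_zero_or_mem_completeConfigs (hK : ∀ k ∈ K, ∀ k' : ι → ℕ, k' ≤ k → k' ∈ K)
    {c : CompleteConfig ι} (h1 : c.1 ∈ K) (h2 : c.2 ≤ c.1) :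
    c = (0, 0) ∨ c ∈ completeConfigs K := by
  by_cases h : c.1 = 0
  · exact Or.inl (Prod.ext h (le_antisymm (h ▸ h2) (zero_le (a := c.2))))
  · exact Or.inr (mem_completeConfigs.2 ⟨⟨h1, hK _ h1 _ h2⟩, h, h2⟩)

lemma numServers_pos {x : State K} {c : CompleteConfig ι} :
    0 < numServers x c ↔ ∃ h : c ∈ completeConfigs K, 0 < x ⟨c, h⟩ := by
  unfold numServers
  split_ifs with h <;> simp [h]

variable (K) in
/-- The sum of `w` over all non-empty servers. -/
noncomputable def totalWeight (w : CompleteConfig ι → ℕ) (x : State K) : ℕ :=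
  ∑ c : {c // c ∈ completeConfigs K}, w c.1 * x c

lemma totalWeight_add (w : CompleteConfig ι → ℕ) (x y : State K) :
    totalWeight K w (x + y) = totalWeight K w x + totalWeight K w y := by
  simp [totalWeight, mul_add, Finset.sum_add_distrib]

lemma totalWeight_oneServer {w : CompleteConfig ι → ℕ} (hw : w (0, 0) = 0) {c : CompleteConfig ι}
    (hc : c = (0, 0) ∨ c ∈ completeConfigs K) : totalWeight K w (oneServer c) = w c := by
  unfold totalWeight oneServer
  by_cases h : c ∈ completeConfigs K
  · rw [Finset.sum_eq_single ⟨c, h⟩]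
    · simp
    · intro b _ hb
      have : b.1 ≠ c := fun e => hb (Subtype.ext e)
      simp [this]
    · simp
  · rw [hc.resolve_right h, hw]
    refine Finset.sum_eq_zero fun d _ => ?_
    have : d.1 ≠ (0, 0) := fun e => h (by rw [hc.resolve_right h, ← e]; exact d.2)
    simp [this]

lemma tokenServers_nonempty {x : State K} {i : ι} :
    (tokenServers x i).Nonempty ↔ 0 < numTokens x i := by
  rw [numTokens, Finset.sum_pos_iff]
  constructor
  · rintro ⟨c, hc⟩
    simp only [tokenServers, Finset.mem_filter] at hc
    obtain ⟨h, hp⟩ := numServers_pos.1 hc.2.1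
    exact ⟨⟨c, h⟩, Finset.mem_univ _, Nat.mul_pos (Nat.sub_pos_of_lt hc.2.2) hp⟩
  · rintro ⟨c, _, hc⟩
    refine ⟨c.1, ?_⟩
    simp only [tokenServers, Finset.mem_filter]
    exact ⟨c.2, numServers_pos.2 ⟨c.2, Nat.pos_of_mul_pos_left hc⟩,
      Nat.lt_of_sub_pos (Nat.pos_of_mul_pos_right hc)⟩

/-- Weight zero for `(0, 0)` lets the same identity cover opening and emptying a server. The
additive form avoids truncated subtraction. -/
lemma totalWeight_moveServer {w : CompleteConfig ι → ℕ} (hw : w (0, 0) = 0)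
    {c c' : CompleteConfig ι} {x : State K} (hc : c = (0, 0) ∨ 0 < numServers x c)
    (hc' : c' = (0, 0) ∨ c' ∈ completeConfigs K) :
    totalWeight K w (moveServer c c' x) + w c = totalWeight K w x + w c' := by
  have hcc : c = (0, 0) ∨ c ∈ completeConfigs K :=
    hc.imp_right fun h => (numServers_pos.1 h).1
  have hx : x - oneServer c + oneServer c = x := by
    funext d
    simp only [Pi.add_apply, Pi.sub_apply]
    refine Nat.sub_add_cancel ?_
    unfold oneServer
    split_ifs with h
    · rcases hc with rfl | hpos
      · exact absurd (congrArg Prod.fst h) (mem_completeConfigs.1 d.2).2.1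
      · obtain ⟨hm, hp⟩ := numServers_pos.1 hpos
        have : d = ⟨c, hm⟩ := Subtype.ext h
        rw [this]; exact hp
    · exact Nat.zero_le _
  have h1 := totalWeight_add w (x - oneServer c) (oneServer c)
  rw [hx, totalWeight_oneServer hw hcc] at h1
  unfold moveServer
  rw [totalWeight_add, totalWeight_oneServer hw hc', h1]
  omega

lemma numActual_moveServer {c c' : CompleteConfig ι} {x : State K}
    (hc : c = (0, 0) ∨ 0 < numServers x c) (hc' : c' = (0, 0) ∨ c' ∈ completeConfigs K) (j : ι) :
    numActual (moveServer c c' x) j + c.2 j = numActual x j + c'.2 j :=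
  totalWeight_moveServer (w := fun c => c.2 j) rfl hc hc'

lemma numTokens_moveServer {c c' : CompleteConfig ι} {x : State K}
    (hc : c = (0, 0) ∨ 0 < numServers x c) (hc' : c' = (0, 0) ∨ c' ∈ completeConfigs K) (j : ι) :
    numTokens (moveServer c c' x) j + (c.1 j - c.2 j) = numTokens x j + (c'.1 j - c'.2 j) :=
  totalWeight_moveServer (w := fun c => c.1 j - c.2 j) rfl hc hc'

/-- A non-empty server holds something of some type `j`, so the servers in one configuration number
at most the customers plus the tokens of that type. -/
lemma finite_setOf_counts_le (N : ℕ) :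
    {x : State K | ∀ j, numActual x j ≤ N ∧ numTokens x j ≤ N}.Finite := by
  refine (Set.finite_Iic (fun _ : {c // c ∈ completeConfigs K} => 2 * N)).subset fun x hx c => ?_
  obtain ⟨-, h0, h3⟩ := mem_completeConfigs.1 c.2
  obtain ⟨j, hj⟩ := Function.ne_iff.1 h0
  have h1 : c.1.2 j * x c ≤ numActual x j :=
    Finset.single_le_sum (f := fun c : {c // c ∈ completeConfigs K} => c.1.2 j * x c)
      (fun _ _ => Nat.zero_le _) (Finset.mem_univ c)
  have h2 : (c.1.1 j - c.1.2 j) * x c ≤ numTokens x j :=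
    Finset.single_le_sum (f := fun c : {c // c ∈ completeConfigs K} => (c.1.1 j - c.1.2 j) * x c)
      (fun _ _ => Nat.zero_le _) (Finset.mem_univ c)
  have h4 : c.1.2 j * x c + (c.1.1 j - c.1.2 j) * x c = c.1.1 j * x c := by
    rw [← add_mul, Nat.add_sub_cancel' (h3 j)]
  have h5 : x c ≤ c.1.1 j * x c := Nat.le_mul_of_pos_left _ (Nat.pos_of_ne_zero hj)
  have := hx j
  show x c ≤ 2 * N
  omega

end Counting

/-! ### Effect of each transition on the counts -/

section Transitions

variable {ι : Type*} [Fintype ι] [DecidableEq ι] {K : Finset (ι → ℕ)}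

lemma counts_replace (hK : ∀ k ∈ K, ∀ k' : ι → ℕ, k' ≤ k → k' ∈ K)
    {x : State K} {i : ι} {c : CompleteConfig ι} (hc : c ∈ tokenServers x i) :
    numActual (moveServer c (c.1, c.2 + unitVec i) x) = numActual x + unitVec i ∧
      numTokens (moveServer c (c.1, c.2 + unitVec i) x) = numTokens x - unitVec i := by
  simp only [tokenServers, Finset.mem_filter] at hc
  obtain ⟨hm, hp, hlt⟩ := hc
  obtain ⟨⟨h1, -⟩, -, h3⟩ := mem_completeConfigs.1 hm
  have hle : c.2 + unitVec i ≤ c.1 := fun j => by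
    have := h3 j
    by_cases hj : j = i
    · subst hj; simpa [unitVec] using hlt
    · simpa [unitVec, hj] using this
  have hc' := eq_zero_or_mem_completeConfigs hK (c := (c.1, c.2 + unitVec i)) h1 hle
  constructor <;> funext j
  · have := numActual_moveServer (Or.inr hp) hc' j
    simp only [Pi.add_apply] at this ⊢
    omega
  · have := numTokens_moveServer (Or.inr hp) hc' j
    have := hle j
    simp only [Pi.add_apply, Pi.sub_apply] at *
    omega

lemma counts_placeCustomer (hK : ∀ k ∈ K, ∀ k' : ι → ℕ, k' ≤ k → k' ∈ K)
    {p : ℝ} {x : State K} {i : ι} {c : CompleteConfig ι}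
    (hc : c ∈ gssChoices p x i) :
    numActual (moveServer c (c.1 + unitVec i, c.2 + unitVec i) x) = numActual x + unitVec i ∧
      numTokens (moveServer c (c.1 + unitVec i, c.2 + unitVec i) x) = numTokens x := by
  simp only [gssChoices, Finset.mem_filter] at hc
  obtain ⟨-, hp, ⟨-, h1⟩, -⟩ := hc
  have h3 : c.2 ≤ c.1 := by
    rcases hp with rfl | hp
    · exact le_rfl
    · exact (mem_completeConfigs.1 (numServers_pos.1 hp).1).2.2
  have hc' := eq_zero_or_mem_completeConfigs hK (c := (c.1 + unitVec i, c.2 + unitVec i)) h1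
    (add_le_add_left h3 _)
  constructor <;> funext j
  · have := numActual_moveServer hp hc' j
    simp only [Pi.add_apply] at this ⊢
    omega
  · have := numTokens_moveServer hp hc' j
    simp only [Pi.add_apply] at this
    omega

lemma counts_placeToken (hK : ∀ k ∈ K, ∀ k' : ι → ℕ, k' ≤ k → k' ∈ K)
    {p : ℝ} {x : State K} {i : ι} {c : CompleteConfig ι}
    (hc : c ∈ gssChoices p x i) :
    numActual (moveServer c (c.1 + unitVec i, c.2) x) = numActual x ∧
      numTokens (moveServer c (c.1 + unitVec i, c.2) x) = numTokens x + unitVec i := by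
  simp only [gssChoices, Finset.mem_filter] at hc
  obtain ⟨-, hp, ⟨-, h1⟩, -⟩ := hc
  have h3 : c.2 ≤ c.1 := by
    rcases hp with rfl | hp
    · exact le_rfl
    · exact (mem_completeConfigs.1 (numServers_pos.1 hp).1).2.2
  have hc' := eq_zero_or_mem_completeConfigs hK (c := (c.1 + unitVec i, c.2)) h1
    (le_add_right h3)
  constructor <;> funext j
  · have := numActual_moveServer hp hc' j
    simp only at this
    omega
  · have := numTokens_moveServer hp hc' j
    have := h3 j
    simp only [Pi.add_apply] at *
    omega

lemma counts_afterService (hK : ∀ k ∈ K, ∀ k' : ι → ℕ, k' ≤ k → k' ∈ K)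
    {x : State K} {i : ι} {c : {c // c ∈ completeConfigs K}}
    (hc : 0 < c.1.2 i * x c) :
    numActual (afterService c.1 i x) = numActual x - unitVec i ∧
      numTokens (afterService c.1 i x) = numTokens x := by
  have hp : 0 < numServers x c.1 := numServers_pos.2 ⟨c.2, Nat.pos_of_mul_pos_left hc⟩
  have hi : 0 < c.1.2 i := Nat.pos_of_mul_pos_right hc
  obtain ⟨⟨h1, -⟩, -, h3⟩ := mem_completeConfigs.1 c.2
  have hu : unitVec i ≤ c.1.2 := fun j => by
    by_cases hj : j = i
    · subst hj; simpa [unitVec] using Nat.succ_le_of_lt hi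
    · simp [unitVec, hj]
  have hc' := eq_zero_or_mem_completeConfigs hK (c := (c.1.1 - unitVec i, c.1.2 - unitVec i))
    (hK _ h1 _ tsub_le_self) (tsub_le_tsub_right h3 _)
  constructor <;> funext j
  · have := numActual_moveServer (Or.inr hp) hc' j
    have := hu j
    simp only [afterService, Pi.sub_apply] at *
    omega
  · have := numTokens_moveServer (Or.inr hp) hc' j
    have := hu j
    have := h3 j
    simp only [afterService, Pi.sub_apply] at *
    omega

lemma counts_timeout (hK : ∀ k ∈ K, ∀ k' : ι → ℕ, k' ≤ k → k' ∈ K)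
    {x : State K} {i : ι} {c : {c // c ∈ completeConfigs K}}
    (hc : 0 < (c.1.1 i - c.1.2 i) * x c) :
    numActual (moveServer c.1 (c.1.1 - unitVec i, c.1.2) x) = numActual x ∧
      numTokens (moveServer c.1 (c.1.1 - unitVec i, c.1.2) x) = numTokens x - unitVec i := by
  have hp : 0 < numServers x c.1 := numServers_pos.2 ⟨c.2, Nat.pos_of_mul_pos_left hc⟩
  have hi : 0 < c.1.1 i - c.1.2 i := Nat.pos_of_mul_pos_right hc
  obtain ⟨⟨h1, -⟩, -, h3⟩ := mem_completeConfigs.1 c.2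
  have hu : c.1.2 + unitVec i ≤ c.1.1 := fun j => by
    have := h3 j
    by_cases hj : j = i
    · subst hj; simp [unitVec]; omega
    · simpa [unitVec, hj] using this
  have hc' := eq_zero_or_mem_completeConfigs hK (c := (c.1.1 - unitVec i, c.1.2))
    (hK _ h1 _ tsub_le_self) (le_tsub_of_add_le_right hu)
  constructor <;> funext j
  · have := numActual_moveServer (Or.inr hp) hc' j
    simp only at this
    omega
  · have := numTokens_moveServer (Or.inr hp) hc' j
    have := hu j
    simp only [Pi.add_apply, Pi.sub_apply] at *
    omega

end Transitions

/-! ### The counts are autonomous -/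

section Generator

variable {ι : Type*} [Fintype ι] [DecidableEq ι] {K : Finset (ι → ℕ)}

/-- The generator of the Markov chain `(Ŷ, Ỹ)` of the numbers of customers and tokens. -/
noncomputable def countGenerator (lam mu : ι → ℝ) (mu0 r : ℝ) (G : (ι → ℕ) → (ι → ℕ) → ℝ) (y z : ι → ℕ) : ℝ :=
  ∑ i, lam i * r * (G (y + unitVec i) (z - unitVec i) - G y z)
    + ∑ i, mu i * y i * (G (y - unitVec i) (z + unitVec i) - G y z)
    + ∑ i, mu0 * z i * (G y (z - unitVec i) - G y z)

lemma IsDistributionOn.sum_mul {α : Type*} {w : α → ℝ} {s : Finset α} (hw : IsDistributionOn w s)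
    {g : α → ℝ} {v : ℝ} (hg : ∀ c ∈ s, g c = v) : ∑ c ∈ s, w c * g c = v := by
  rw [Finset.sum_congr rfl fun c hc => by rw [hg c hc], ← Finset.sum_mul, hw.2.2, one_mul]

/-- The numbers of customers and tokens evolve autonomously, whatever the placement decisions. -/
lemma generator_counts (hK : ∀ k ∈ K, ∀ k' : ι → ℕ, k' ≤ k → k' ∈ K)
    (lam mu : ι → ℝ) (mu0 r : ℝ) {p : ℝ} (τ : TieBreaking K p)
    (G : (ι → ℕ) → (ι → ℕ) → ℝ) (x : State K) :
    generator lam mu mu0 r τ (fun x => G (numActual x) (numTokens x)) x =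
      countGenerator lam mu mu0 r G (numActual x) (numTokens x) := by
  unfold generator countGenerator
  congr 1
  · congr 1
    · refine Finset.sum_congr rfl fun i _ => ?_
      congr 1
      unfold arrivalChange
      split_ifs with h
      · refine (τ.replace_spec i x h).sum_mul fun c hc => ?_
        simp only [counts_replace hK hc]
      -- Without type-`i` tokens the truncated subtraction in `countGenerator` does nothing, so one
      -- formula serves both kinds of arrival.
      · refine (τ.placeCustomer_spec i x).sum_mul fun c hc => ?_
        have : numTokens x - unitVec i = numTokens x := by
          funext j
          rw [tokenServers_nonempty, not_lt, Nat.le_zero] at h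
          by_cases hj : j = i
          · subst hj; simp [h]
          · simp [unitVec, hj]
        simp only [counts_placeCustomer hK hc, this]
    · refine Finset.sum_congr rfl fun i _ => ?_
      rw [numActual, Nat.cast_sum, Finset.mul_sum, Finset.sum_mul]
      refine Finset.sum_congr rfl fun c _ => ?_
      rcases Nat.eq_zero_or_pos (c.1.2 i * x c) with h | h
      · simp [h]
      · congr 1
        refine (τ.placeToken_spec i c _).sum_mul fun d hd => ?_
        simp only [counts_placeToken hK hd, counts_afterService hK h]
  · refine Finset.sum_congr rfl fun i _ => ?_
    rw [numTokens, Nat.cast_sum, Finset.mul_sum, Finset.sum_mul]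
    refine Finset.sum_congr rfl fun c _ => ?_
    rcases Nat.eq_zero_or_pos ((c.1.1 i - c.1.2 i) * x c) with h | h
    · simp [h]
    · congr 1
      simp only [timeoutChange, counts_timeout hK h]

end Generator

/-! ### From drift of the counts to Lyapunov functions -/

section Drift

variable {ι : Type*} [Fintype ι] [DecidableEq ι] {K : Finset (ι → ℕ)}

lemma countGenerator_mono {lam mu : ι → ℝ} {mu0 r : ℝ} (hlam : ∀ i, 0 ≤ lam i)
    (hmu : ∀ i, 0 ≤ mu i) (hmu0 : 0 ≤ mu0) (hr : 0 ≤ r) {G G' : (ι → ℕ) → (ι → ℕ) → ℝ}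
    {y z : ι → ℕ} (h : ∀ y' z', G y' z' - G y z ≤ G' y' z' - G' y z) :
    countGenerator lam mu mu0 r G y z ≤ countGenerator lam mu mu0 r G' y z := by
  unfold countGenerator
  refine add_le_add (add_le_add ?_ ?_) ?_ <;>
    refine Finset.sum_le_sum fun i _ => mul_le_mul_of_nonneg_left (h _ _) ?_
  · exact mul_nonneg (hlam i) hr
  · exact mul_nonneg (hmu i) (Nat.cast_nonneg _)
  · exact mul_nonneg hmu0 (Nat.cast_nonneg _)

lemma countGenerator_eq_zero {lam mu : ι → ℝ} {mu0 r : ℝ} {G : (ι → ℕ) → (ι → ℕ) → ℝ}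
    {y z : ι → ℕ} (h : ∀ y' z', (∀ j, y j ≤ y' j + 1 ∧ z j ≤ z' j + 1) → G y' z' = 0) :
    countGenerator lam mu mu0 r G y z = 0 := by
  have h0 : G y z = 0 := h _ _ fun j => ⟨by omega, by omega⟩
  have hu : ∀ i j : ι, unitVec i j ≤ 1 := fun i j => by
    by_cases hj : j = i
    · subst hj; simp [unitVec]
    · simp [unitVec, hj]
  have h1 : ∀ i, G (y + unitVec i) (z - unitVec i) = 0 := fun i => h _ _ fun j => by
    have := hu i j
    simp only [Pi.add_apply, Pi.sub_apply]; omega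
  have h2 : ∀ i, G (y - unitVec i) (z + unitVec i) = 0 := fun i => h _ _ fun j => by
    have := hu i j
    simp only [Pi.add_apply, Pi.sub_apply]; omega
  have h3 : ∀ i, G y (z - unitVec i) = 0 := fun i => h _ _ fun j => by
    have := hu i j
    simp only [Pi.sub_apply]; omega
  simp [countGenerator, h0, h1, h2, h3]

/-- Truncation only helps the drift: below level `a` the increments of `min G a` are at most those
of `G`, and from level `a` on they are nonpositive. -/
lemma isLyapunov_counts (hK : ∀ k ∈ K, ∀ k' : ι → ℕ, k' ≤ k → k' ∈ K)
    {lam mu : ι → ℝ} {mu0 r : ℝ} (hlam : ∀ i, 0 ≤ lam i)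
    (hmu : ∀ i, 0 ≤ mu i) (hmu0 : 0 ≤ mu0) (hr : 0 ≤ r) {p : ℝ} (τ : TieBreaking K p)
    {G : (ι → ℕ) → (ι → ℕ) → ℝ} {c C : ℝ} (hG : ∀ y z, 0 ≤ G y z)
    (hco : ∀ a, ∃ N : ℕ, ∀ y z, G y z < a → ∀ j, y j ≤ N ∧ z j ≤ N)
    (hd : ∀ y z, countGenerator lam mu mu0 r G y z ≤ C - c * G y z) :
    IsLyapunov (generator lam mu mu0 r τ) (fun x : State K => G (numActual x) (numTokens x))
      c C where
  nonneg x := hG _ _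
  finite_sublevel a := by
    obtain ⟨N, hN⟩ := hco a
    exact (finite_setOf_counts_le N).subset fun x hx => hN _ _ hx
  bounded a := by
    obtain ⟨N, hN⟩ := hco a
    -- A transition changes each count by at most one, so beyond `N + 1` the generator sees only
    -- zeros of the truncated function.
    refine exists_bound_of_finite_support
      ((finite_setOf_counts_le (K := K) (N + 1)).subset fun x hx => ?_)
    by_contra hx'
    refine hx ?_
    rw [generator_counts hK lam mu mu0 r τ fun y z => min (G y z) a - a]
    refine countGenerator_eq_zero fun y' z' h => ?_
    have : a ≤ G y' z' := by
      by_contra hlt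
      refine hx' fun j => ?_
      have := hN _ _ (not_le.1 hlt) j
      have := h j
      omega
    simp [this]
  drift_of_lt a x hx := by
    rw [generator_counts hK lam mu mu0 r τ fun y z => min (G y z) a - a]
    refine (countGenerator_mono hlam hmu hmu0 hr fun y' z' => ?_).trans (hd _ _)
    rw [min_eq_left hx.le]
    linarith [min_le_left (G y' z') a]
  drift_of_le a x hx := by
    rw [generator_counts hK lam mu mu0 r τ fun y z => min (G y z) a - a]
    refine (countGenerator_mono (G' := fun _ _ => 0) hlam hmu hmu0 hr fun y' z' => ?_).trans
      (le_of_eq (by simp [countGenerator]))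
    rw [min_eq_right hx]
    linarith [min_le_right (G y' z') a]

end Drift

/-! ### Taylor and Young inequalities for powers -/

section PowerBounds

lemma exists_abs_add_pow_sub_le (n : ℕ) : ∃ B : ℝ, 0 ≤ B ∧ ∀ x h A : ℝ, |h| ≤ 1 → |x| ≤ A → 1 ≤ A →
    |(x + h) ^ (n + 2) - x ^ (n + 2) - (n + 2) * h * x ^ (n + 1)| ≤ B * A ^ n := by
  induction n with
  | zero =>
    refine ⟨1, zero_le_one, fun x h A hh _ _ => ?_⟩
    have : (x + h) ^ (0 + 2) - x ^ (0 + 2) - ((0 : ℕ) + 2) * h * x ^ (0 + 1) = h ^ 2 := by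
      push_cast; ring
    rw [this, abs_pow]
    simpa using hh
  | succ n ih =>
    obtain ⟨B, hB, ih⟩ := ih
    refine ⟨2 * B + (n + 2), by positivity, fun x h A hh hx hA => ?_⟩
    set e := (x + h) ^ (n + 2) - x ^ (n + 2) - (n + 2) * h * x ^ (n + 1) with he
    have h1 : (x + h) ^ (n + 1 + 2) - x ^ (n + 1 + 2) -
        ((n + 1 : ℕ) + 2) * h * x ^ (n + 1 + 1) = (x + h) * e + (n + 2) * (h ^ 2 * x ^ (n + 1)) := by
      rw [he]; push_cast; ring
    rw [h1]
    have h2 : |x + h| ≤ 2 * A := by linarith [abs_add_le x h]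
    have h3 : |h ^ 2 * x ^ (n + 1)| ≤ 1 * A ^ (n + 1) := by
      rw [abs_mul, abs_pow, abs_pow]
      gcongr
      exact pow_le_one₀ (abs_nonneg h) hh
    calc |(x + h) * e + (n + 2) * (h ^ 2 * x ^ (n + 1))|
        ≤ |x + h| * |e| + (n + 2) * |h ^ 2 * x ^ (n + 1)| := by
          refine (abs_add_le _ _).trans (le_of_eq ?_)
          rw [abs_mul, abs_mul ((n : ℝ) + 2), abs_of_nonneg (by positivity : (0 : ℝ) ≤ n + 2)]
      _ ≤ 2 * A * (B * A ^ n) + (n + 2) * (1 * A ^ (n + 1)) := by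
          gcongr
          exact ih x h A hh hx hA
      _ = (2 * B + (n + 2)) * A ^ (n + 1) := by ring

/-- A Young inequality, by comparing `a` with `ε * b`. -/
lemma exists_mul_pow_le (n : ℕ) {ε : ℝ} (hε : 0 < ε) : ∃ C : ℝ, 0 ≤ C ∧ ∀ a b : ℝ, 0 ≤ a → 0 ≤ b →
    a * b ^ (n + 1) ≤ ε * b ^ (n + 2) + C * a ^ (n + 2) := by
  refine ⟨(ε ^ (n + 1))⁻¹, by positivity, fun a b ha hb => ?_⟩
  rcases le_total a (ε * b) with h | h
  · calc a * b ^ (n + 1) ≤ ε * b * b ^ (n + 1) := by gcongr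
      _ = ε * b ^ (n + 2) := by ring
      _ ≤ _ := le_add_of_nonneg_right (by positivity)
  · have h' : b ≤ a / ε := by rwa [le_div_iff₀' hε]
    calc a * b ^ (n + 1) ≤ a * (a / ε) ^ (n + 1) := by gcongr
      _ = (ε ^ (n + 1))⁻¹ * a ^ (n + 2) := by rw [div_pow]; field_simp; ring
      _ ≤ _ := le_add_of_nonneg_left (by positivity)

lemma add_three_pow_le (n : ℕ) {a b c : ℝ} (ha : 0 ≤ a) (hb : 0 ≤ b) (hc : 0 ≤ c) :
    (a + b + c) ^ n ≤ 3 ^ n * (a ^ n + b ^ n + c ^ n) := by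
  have hm : max a (max b c) ^ n ≤ a ^ n + b ^ n + c ^ n := by
    have := pow_nonneg ha n
    have := pow_nonneg hb n
    have := pow_nonneg hc n
    rcases max_cases a (max b c) with ⟨h, -⟩ | ⟨h, -⟩ <;> rw [h]
    · linarith
    · rcases max_cases b c with ⟨h, -⟩ | ⟨h, -⟩ <;> rw [h] <;> linarith
  calc (a + b + c) ^ n ≤ (3 * max a (max b c)) ^ n := by
        gcongr
        have := le_max_left a (max b c)
        have := (le_max_left b c).trans (le_max_right a (max b c))
        have := (le_max_right b c).trans (le_max_right a (max b c))
        linarith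
    _ = 3 ^ n * max a (max b c) ^ n := mul_pow ..
    _ ≤ _ := by gcongr

end PowerBounds

/-! ### Drift for one customer type -/

section SingleType

/-- The Lyapunov function for the numbers `y` and `z` of customers and tokens of one type. -/
noncomputable def typeLyapunov (n : ℕ) (κ m : ℝ) (y z : ℕ) : ℝ :=
  κ * (y - m) ^ (n + 2) + (z : ℝ) ^ (n + 2)

/-- The generator of the numbers of customers and tokens of one type. -/
noncomputable def typeGenerator (l m m0 r : ℝ) (H : ℕ → ℕ → ℝ) (y z : ℕ) : ℝ :=
  l * r * (H (y + 1) (z - 1) - H y z) + m * y * (H (y - 1) (z + 1) - H y z)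
    + m0 * z * (H y (z - 1) - H y z)

/-- Removes truncated subtraction. It matters only at zero counts, where a service or timeout has
rate 0, and an arrival costs at most the nonnegative even power of −1. -/
lemma typeGenerator_typeLyapunov_le {n : ℕ} (hn : Even n) {l m m0 r κ ρ : ℝ} (hl : 0 ≤ l)
    (hr : 0 ≤ r) (y z : ℕ) :
    typeGenerator l m m0 r (typeLyapunov n κ ρ) y z ≤
      κ * (l * r * ((y - ρ + 1) ^ (n + 2) - (y - ρ) ^ (n + 2))
        + m * y * ((y - ρ + -1) ^ (n + 2) - (y - ρ) ^ (n + 2)))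
      + (l * r * (((z : ℝ) + -1) ^ (n + 2) - (z : ℝ) ^ (n + 2))
        + m * y * (((z : ℝ) + 1) ^ (n + 2) - (z : ℝ) ^ (n + 2))
        + m0 * z * (((z : ℝ) + -1) ^ (n + 2) - (z : ℝ) ^ (n + 2))) := by
  have hn2 : Even (n + 2) := hn.add even_two
  have hz : ((z - 1 : ℕ) : ℝ) ^ (n + 2) ≤ ((z : ℝ) + -1) ^ (n + 2) := by
    rcases z with _ | z
    · simpa using hn2.pow_nonneg (-1 : ℝ)
    · simp
  have hz' : (z : ℝ) * ((z - 1 : ℕ) : ℝ) ^ (n + 2) = z * ((z : ℝ) + -1) ^ (n + 2) := by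
    rcases z with _ | z <;> simp
  have hy' : (y : ℝ) * (((y - 1 : ℕ) : ℝ) - ρ) ^ (n + 2) = y * (y - ρ + -1) ^ (n + 2) := by
    rcases y with _ | y
    · simp
    · congr 2; push_cast; ring
  have hlr : 0 ≤ l * r := mul_nonneg hl hr
  have h1 := mul_le_mul_of_nonneg_left hz hlr
  unfold typeGenerator typeLyapunov
  push_cast
  have e : (y : ℝ) + 1 - ρ = y - ρ + 1 := by ring
  rw [e]
  linear_combination h1 + m0 * hz' + m * κ * hy'

/-- The drift inequality for one customer type. The exponent `n + 2` is arbitrary and even, the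
constants do not depend on the scale `r`. -/
lemma exists_typeGenerator_le {n : ℕ} (hn : Even n) {l m m0 : ℝ} (hl : 0 < l) (hm : 0 < m)
    (hm0 : 0 < m0) : ∃ κ c C : ℝ, 1 ≤ κ ∧ 0 < c ∧ 0 ≤ C ∧ ∀ r : ℝ, 1 ≤ r → ∀ y z : ℕ,
      typeGenerator l m m0 r (typeLyapunov n κ (l / m * r)) y z ≤
        C * √r ^ (n + 2) - c * typeLyapunov n κ (l / m * r) y z := by
  obtain ⟨B, hB, hT⟩ := exists_abs_add_pow_sub_le n
  obtain ⟨C₁, hC₁, hY₁⟩ := exists_mul_pow_le n (ε := m0 / (2 * m)) (by positivity)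
  -- Young's inequality for the cross term spends `C₁` copies of the contraction in `u`; this weight
  -- leaves exactly one.
  set κ := C₁ + 1 with hκ
  set B' := κ * (B * (2 * l + m)) + B * (2 * l + m + m0) with hB'
  set d := min (m * (n + 2)) (m0 * (n + 2) / 2) with hd
  have hd0 : 0 < d := lt_min (by positivity) (by positivity)
  have hB'0 : 0 ≤ B' := by positivity
  -- The small parameter makes the second-order errors, with total coefficient `B'`, consume at most
  -- half of the decay `d`.
  obtain ⟨C₂, hC₂, hY₂⟩ := exists_mul_pow_le n (ε := d / (2 * 3 ^ (n + 2) * (B' + 1)))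
    (by positivity)
  refine ⟨κ, d / (2 * κ), B' * C₂ + d / 2, by linarith, by positivity, by positivity,
    fun r hr y z => (typeGenerator_typeLyapunov_le hn hl.le (by linarith) y z).trans ?_⟩
  have hn2 : Even (n + 2) := hn.add even_two
  set u : ℝ := y - l / m * r with hu
  set s := √r with hs
  have hs1 : 1 ≤ s := by rwa [hs, Real.one_le_sqrt]
  have hsr : r = s * s := (Real.mul_self_sqrt (by linarith)).symm
  -- A common majorant: since `r = s * s` and `s ≤ A`, every second-order term is at most a constant
  -- times `s * A ^ (n + 1)`.
  set A := |u| + z + s with hA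
  have hz0 : (0 : ℝ) ≤ z := Nat.cast_nonneg z
  have hy0 : (0 : ℝ) ≤ y := Nat.cast_nonneg y
  have hu0 := abs_nonneg u
  have hA1 : 1 ≤ A := by linarith
  have hmy : m * y = m * u + l * r := by rw [hu]; field_simp; ring
  have hup : ∀ x h : ℝ, |h| ≤ 1 → |x| ≤ A →
      (x + h) ^ (n + 2) - x ^ (n + 2) ≤ (n + 2) * h * x ^ (n + 1) + B * A ^ n := fun x h hh hx => by
    have := (le_abs_self _).trans (hT x h A hh hx hA1)
    linarith
  have huA : |u| ≤ A := by linarith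
  have hzA : |(z : ℝ)| ≤ A := by rw [abs_of_nonneg hz0]; linarith
  have hlr : 0 ≤ l * r := by rw [hsr]; positivity
  have hmy0 : 0 ≤ m * y := by positivity
  have hmz0 : 0 ≤ m0 * z := by positivity
  have hAn : 0 ≤ A ^ n := by positivity
  have hr1 : r * A ^ n ≤ s * A ^ (n + 1) := by
    rw [hsr, pow_succ', mul_assoc]
    gcongr
    linarith
  have hu1 : u * A ^ n ≤ s * A ^ (n + 1) := by
    calc u * A ^ n ≤ A * A ^ n := by gcongr; exact (le_abs_self u).trans huA
      _ = 1 * A ^ (n + 1) := by ring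
      _ ≤ _ := by gcongr
  have hz1 : z * A ^ n ≤ s * A ^ (n + 1) := by
    calc z * A ^ n ≤ A * A ^ n := by gcongr; exact (le_abs_self _).trans hzA
      _ = 1 * A ^ (n + 1) := by ring
      _ ≤ _ := by gcongr
  have hU : l * r * ((u + 1) ^ (n + 2) - u ^ (n + 2)) + m * y * ((u + -1) ^ (n + 2) - u ^ (n + 2))
      ≤ -(m * (n + 2)) * u ^ (n + 2) + B * (2 * l + m) * (s * A ^ (n + 1)) := by
    have h1 := mul_le_mul_of_nonneg_left (hup u 1 (by simp) huA) hlr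
    have h2 := mul_le_mul_of_nonneg_left (hup u (-1) (by simp) huA) hmy0
    have h3 : B * (l * r + m * y) * A ^ n ≤ B * (2 * l + m) * (s * A ^ (n + 1)) := by
      have : (l * r + m * y) * A ^ n ≤ (2 * l + m) * (s * A ^ (n + 1)) := by
        rw [hmy]
        linear_combination 2 * l * hr1 + m * hu1
      rw [mul_assoc, mul_assoc]
      gcongr
    have h4 : (l * r - m * y) * ((n + 2) * u ^ (n + 1)) = -(m * (n + 2)) * u ^ (n + 2) := by
      rw [hmy]; ring
    linarith
  have hZ : l * r * (((z : ℝ) + -1) ^ (n + 2) - (z : ℝ) ^ (n + 2))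
        + m * y * (((z : ℝ) + 1) ^ (n + 2) - (z : ℝ) ^ (n + 2))
        + m0 * z * (((z : ℝ) + -1) ^ (n + 2) - (z : ℝ) ^ (n + 2))
      ≤ m * (n + 2) * (|u| * (z : ℝ) ^ (n + 1)) - m0 * (n + 2) * (z : ℝ) ^ (n + 2)
        + B * (2 * l + m + m0) * (s * A ^ (n + 1)) := by
    have h1 := mul_le_mul_of_nonneg_left (hup z (-1) (by simp) hzA) hlr
    have h2 := mul_le_mul_of_nonneg_left (hup z 1 (by simp) hzA) hmy0
    have h3 := mul_le_mul_of_nonneg_left (hup z (-1) (by simp) hzA) hmz0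
    have h4 : B * (l * r + m * y + m0 * z) * A ^ n ≤ B * (2 * l + m + m0) * (s * A ^ (n + 1)) := by
      have : (l * r + m * y + m0 * z) * A ^ n ≤ (2 * l + m + m0) * (s * A ^ (n + 1)) := by
        rw [hmy]
        linear_combination 2 * l * hr1 + m * hu1 + m0 * hz1
      rw [mul_assoc, mul_assoc]
      gcongr
    have h5 : (m * y - l * r - m0 * z) * ((n + 2) * (z : ℝ) ^ (n + 1)) =
        m * (n + 2) * (u * (z : ℝ) ^ (n + 1)) - m0 * (n + 2) * (z : ℝ) ^ (n + 2) := by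
      rw [hmy]; ring
    have h6 : m * (n + 2) * (u * (z : ℝ) ^ (n + 1)) ≤ m * (n + 2) * (|u| * (z : ℝ) ^ (n + 1)) := by
      gcongr
      exact le_abs_self u
    linarith
  have hcross : m * (n + 2) * (|u| * (z : ℝ) ^ (n + 1)) ≤
      m0 * (n + 2) / 2 * (z : ℝ) ^ (n + 2) + m * (n + 2) * C₁ * u ^ (n + 2) := by
    have h1 := mul_le_mul_of_nonneg_left (hY₁ |u| z hu0 hz0)
      (by positivity : 0 ≤ m * ((n : ℝ) + 2))
    rw [hn2.pow_abs] at h1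
    refine h1.trans (le_of_eq ?_)
    field_simp
  have hκ0 : 0 < κ := by linarith
  have hUκ := mul_le_mul_of_nonneg_left hU hκ0.le
  have hup0 : 0 ≤ u ^ (n + 2) := hn2.pow_nonneg u
  have hzp0 : 0 ≤ (z : ℝ) ^ (n + 2) := by positivity
  have hsp0 : 0 ≤ s ^ (n + 2) := by positivity
  have hYA := hY₂ s A (by linarith) (by linarith)
  have hA3 : A ^ (n + 2) ≤ 3 ^ (n + 2) * (u ^ (n + 2) + (z : ℝ) ^ (n + 2) + s ^ (n + 2)) := by
    have := add_three_pow_le (n + 2) hu0 hz0 (by linarith : 0 ≤ s)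
    rwa [hn2.pow_abs] at this
  have herr : B' * (s * A ^ (n + 1)) ≤
      d / 2 * (u ^ (n + 2) + (z : ℝ) ^ (n + 2) + s ^ (n + 2)) + B' * C₂ * s ^ (n + 2) := by
    have h1 : B' * (d / (2 * 3 ^ (n + 2) * (B' + 1)) * A ^ (n + 2)) ≤
        d / 2 * (u ^ (n + 2) + (z : ℝ) ^ (n + 2) + s ^ (n + 2)) := by
      calc B' * (d / (2 * 3 ^ (n + 2) * (B' + 1)) * A ^ (n + 2))
          ≤ (B' + 1) * (d / (2 * 3 ^ (n + 2) * (B' + 1)) *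
            (3 ^ (n + 2) * (u ^ (n + 2) + (z : ℝ) ^ (n + 2) + s ^ (n + 2)))) := by
            gcongr
            linarith
        _ = _ := by field_simp
    have h2 := mul_le_mul_of_nonneg_left hYA hB'0
    linarith
  have hdu : d * u ^ (n + 2) ≤ m * (n + 2) * u ^ (n + 2) := by gcongr; exact min_le_left _ _
  have hdz : d * (z : ℝ) ^ (n + 2) ≤ m0 * (n + 2) / 2 * (z : ℝ) ^ (n + 2) := by
    gcongr; exact min_le_right _ _
  have hlow : d / (2 * κ) * typeLyapunov n κ (l / m * r) y z ≤
      d / 2 * (u ^ (n + 2) + (z : ℝ) ^ (n + 2)) := by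
    have : typeLyapunov n κ (l / m * r) y z ≤ κ * (u ^ (n + 2) + (z : ℝ) ^ (n + 2)) := by
      unfold typeLyapunov
      rw [mul_add]
      gcongr
      exact le_mul_of_one_le_left hzp0 (by linarith)
    calc _ ≤ d / (2 * κ) * (κ * (u ^ (n + 2) + (z : ℝ) ^ (n + 2))) := by gcongr
      _ = _ := by field_simp
  have e1 : κ * (-(m * (n + 2)) * u ^ (n + 2) + B * (2 * l + m) * (s * A ^ (n + 1))) +
      B * (2 * l + m + m0) * (s * A ^ (n + 1)) + m * (n + 2) * C₁ * u ^ (n + 2) =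
      -(m * (n + 2) * u ^ (n + 2)) + B' * (s * A ^ (n + 1)) := by
    rw [hB', hκ]; ring
  linarith

end SingleType

/-! ### Summing over customer types -/

section SystemLyapunov

variable {ι : Type*} [Fintype ι]

/-- The Lyapunov function for the numbers of customers and tokens of all types. -/
noncomputable def systemLyapunov (n : ℕ) (κ m : ι → ℝ) (y z : ι → ℕ) : ℝ :=
  ∑ j, typeLyapunov n (κ j) (m j) (y j) (z j)

lemma typeLyapunov_nonneg {n : ℕ} (hn : Even n) {κ : ℝ} (hκ : 0 ≤ κ) (m : ℝ) (y z : ℕ) :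
    0 ≤ typeLyapunov n κ m y z :=
  add_nonneg (mul_nonneg hκ ((hn.add even_two).pow_nonneg _)) (by positivity)

lemma typeLyapunov_le_systemLyapunov {n : ℕ} (hn : Even n) {κ : ι → ℝ} (hκ : ∀ j, 0 ≤ κ j)
    (m : ι → ℝ) (y z : ι → ℕ) (j : ι) :
    typeLyapunov n (κ j) (m j) (y j) (z j) ≤ systemLyapunov n κ m y z :=
  Finset.single_le_sum (f := fun j => typeLyapunov n (κ j) (m j) (y j) (z j))
    (fun j _ => typeLyapunov_nonneg hn (hκ j) _ _ _) (Finset.mem_univ j)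

lemma max_pow_le_typeLyapunov {n : ℕ} (hn : Even n) {κ : ℝ} (hκ : 1 ≤ κ) (m : ℝ) (y z : ℕ) :
    max |y - m| (z : ℝ) ^ (n + 2) ≤ typeLyapunov n κ m y z := by
  have hn2 : Even (n + 2) := hn.add even_two
  have h0 := hn2.pow_nonneg ((y : ℝ) - m)
  have h1 : (0 : ℝ) ≤ (z : ℝ) ^ (n + 2) := by positivity
  have h2 := mul_le_mul_of_nonneg_right hκ h0
  unfold typeLyapunov
  rcases max_cases |y - m| (z : ℝ) with ⟨h, -⟩ | ⟨h, -⟩ <;> rw [h]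
  · rw [hn2.pow_abs]; linarith
  · linarith

lemma le_one_add_typeLyapunov {n : ℕ} (hn : Even n) {κ : ℝ} (hκ : 1 ≤ κ) (m : ℝ) (y z : ℕ) :
    max |y - m| (z : ℝ) ≤ 1 + typeLyapunov n κ m y z := by
  refine le_trans ?_ (add_le_add_right (max_pow_le_typeLyapunov hn hκ m y z) 1)
  have h0 : 0 ≤ max |y - m| (z : ℝ) := le_max_of_le_left (abs_nonneg _)
  rcases le_total (max |y - m| (z : ℝ)) 1 with h | h
  · have := pow_nonneg h0 (n + 2); linarith
  · have := le_self_pow₀ h (by omega : n + 2 ≠ 0); linarith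

lemma systemLyapunov_coercive {n : ℕ} (hn : Even n) {κ : ι → ℝ} (hκ : ∀ j, 1 ≤ κ j)
    (m : ι → ℝ) (a : ℝ) :
    ∃ N : ℕ, ∀ y z, systemLyapunov n κ m y z < a → ∀ j, y j ≤ N ∧ z j ≤ N := by
  obtain ⟨N, hN⟩ := exists_nat_ge (∑ j, |m j| + (1 + a))
  refine ⟨N, fun y z h j => ?_⟩
  have h1 := typeLyapunov_le_systemLyapunov hn (fun j => zero_le_one.trans (hκ j)) m y z j
  have h2 := le_one_add_typeLyapunov hn (hκ j) (m j) (y j) (z j)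
  have h3 : |m j| ≤ ∑ j, |m j| :=
    Finset.single_le_sum (f := fun j => |m j|) (fun _ _ => abs_nonneg _) (Finset.mem_univ j)
  have h4 := (le_max_left _ _).trans h2
  have h5 := (le_max_right _ _).trans h2
  have h6 := (abs_le.1 h4).2
  have h7 := le_abs_self (m j)
  have h8 := abs_nonneg (m j)
  constructor
  · have : (y j : ℝ) ≤ N := by linarith
    exact_mod_cast this
  · have : (z j : ℝ) ≤ N := by linarith
    exact_mod_cast this

lemma sum_sub_sum_eq {f : ι → ℕ → ℕ → ℝ} {y y' z z' : ι → ℕ} {i : ι}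
    (h : ∀ j, j ≠ i → y' j = y j ∧ z' j = z j) :
    ∑ j, f j (y' j) (z' j) - ∑ j, f j (y j) (z j) = f i (y' i) (z' i) - f i (y i) (z i) := by
  rw [← Finset.sum_sub_distrib, Finset.sum_eq_single i]
  · intro j _ hj
    rw [(h j hj).1, (h j hj).2, sub_self]
  · simp

variable [DecidableEq ι]

/-- Each transition touches a single type, so only that summand contributes to the increment. -/
lemma countGenerator_sum (lam mu : ι → ℝ) (mu0 r : ℝ) (f : ι → ℕ → ℕ → ℝ) (y z : ι → ℕ) :
    countGenerator lam mu mu0 r (fun y z => ∑ j, f j (y j) (z j)) y z =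
      ∑ i, typeGenerator (lam i) (mu i) mu0 r (f i) (y i) (z i) := by
  unfold countGenerator typeGenerator
  rw [← Finset.sum_add_distrib, ← Finset.sum_add_distrib]
  refine Finset.sum_congr rfl fun i _ => ?_
  have hu : ∀ j, j ≠ i → unitVec i j = 0 := fun j hj => by simp [unitVec, hj]
  have hui : unitVec i i = 1 := by simp [unitVec]
  rw [sum_sub_sum_eq (i := i) (fun j hj => by simp [hu j hj]),
    sum_sub_sum_eq (i := i) (fun j hj => by simp [hu j hj]),
    sum_sub_sum_eq (i := i) (fun j hj => by simp [hu j hj])]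
  simp only [Pi.add_apply, Pi.sub_apply, hui]

variable {K : Finset (ι → ℕ)}

/-- For every even exponent there is a Lyapunov function of the whole system, with constants that
do not depend on the scale. -/
theorem exists_isLyapunov [Nonempty ι] (hK : ∀ k ∈ K, ∀ k' : ι → ℕ, k' ≤ k → k' ∈ K)
    {lam mu : ι → ℝ} {mu0 : ℝ} (hlam : ∀ i, 0 < lam i) (hmu : ∀ i, 0 < mu i) (hmu0 : 0 < mu0)
    {n : ℕ} (hn : Even n) :
    ∃ (κ : ι → ℝ) (c C : ℝ), (∀ j, 1 ≤ κ j) ∧ 0 < c ∧ 0 ≤ C ∧ ∀ r : ℝ, 1 ≤ r →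
      ∀ (p : ℝ) (τ : TieBreaking K p),
      IsLyapunov (generator lam mu mu0 r τ)
        (fun x : State K => systemLyapunov n κ (fun j => lam j / mu j * r) (numActual x)
          (numTokens x)) c (C * √r ^ (n + 2)) := by
  choose κ c C hκ hc hC h using fun i => exists_typeGenerator_le hn (hlam i) (hmu i) hmu0
  -- The slowest type dictates the common decay rate.
  obtain ⟨i₀, hi₀⟩ := Finite.exists_min c
  refine ⟨κ, c i₀, ∑ i, C i, hκ, hc i₀, Finset.sum_nonneg fun i _ => hC i, fun r hr p τ => ?_⟩
  have hκ0 : ∀ j, 0 ≤ κ j := fun j => zero_le_one.trans (hκ j)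
  refine isLyapunov_counts hK (fun i => (hlam i).le) (fun i => (hmu i).le) hmu0.le (by linarith) τ
    (fun y z => Finset.sum_nonneg fun j _ => typeLyapunov_nonneg hn (hκ0 j) _ _ _)
    (systemLyapunov_coercive hn hκ _) fun y z => ?_
  refine (countGenerator_sum lam mu mu0 r
    (fun j => typeLyapunov n (κ j) (lam j / mu j * r)) y z).trans_le ?_
  rw [systemLyapunov, Finset.sum_mul, Finset.mul_sum, ← Finset.sum_sub_distrib]
  refine Finset.sum_le_sum fun i _ => (h i r hr (y i) (z i)).trans ?_
  gcongr
  · exact typeLyapunov_nonneg hn (hκ0 i) _ _ _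
  · exact hi₀ i

end SystemLyapunov

/-! ### Deviations are dominated by the Lyapunov function -/

section Deviations

variable {ι : Type*} [Fintype ι] {K : Finset (ι → ℕ)}

lemma typeDeviation_nonneg {r : ℝ} (hr : 0 ≤ r) (q ρ : ℝ) (i : ι) (x : State K) :
    0 ≤ typeDeviation r q ρ i x :=
  mul_nonneg (Real.rpow_nonneg hr _) (by positivity)

/-- One of the two components carries at least half of the 1-norm, hence the factor 1/2. -/
lemma pow_le_systemLyapunov_of_le_typeDeviation {n : ℕ} (hn : Even n) {κ : ι → ℝ}
    (hκ : ∀ j, 1 ≤ κ j) {r q ε : ℝ} (hr : 0 < r) (hε : 0 ≤ ε) {m : ι → ℝ} {i : ι} {x : State K}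
    (h : ε ≤ typeDeviation r q (m i) i x) :
    (ε / 2 * r ^ q) ^ (n + 2) ≤
      systemLyapunov n κ (fun j => m j * r) (numActual x) (numTokens x) := by
  refine le_trans ?_ ((max_pow_le_typeLyapunov hn (hκ i) (m i * r) _ _).trans
    (typeLyapunov_le_systemLyapunov hn (fun j => zero_le_one.trans (hκ j))
      (fun j => m j * r) _ _ i))
  have hrq : 0 < r ^ q := Real.rpow_pos_of_pos hr q
  gcongr
  unfold typeDeviation at h
  rw [Real.rpow_neg hr.le, inv_mul_eq_div, le_div_iff₀ hrq, Nat.abs_cast] at h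
  have h1 := le_max_left |(numActual x i : ℝ) - m i * r| (numTokens x i : ℝ)
  have h2 := le_max_right |(numActual x i : ℝ) - m i * r| (numTokens x i : ℝ)
  linarith

lemma totalDeviation_le_sum {r q : ℝ} (hr : 0 ≤ r) {m : ι → ℝ} (hm : ∑ i, m i = 1) (x : State K) :
    totalDeviation r q x ≤ ∑ i, typeDeviation r q (m i) i x := by
  unfold totalDeviation typeDeviation
  rw [← Finset.mul_sum]
  have hrq := Real.rpow_nonneg hr (-q)
  gcongr
  have : (totalActual x : ℝ) - r = ∑ i, ((numActual x i : ℝ) - m i * r) := by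
    rw [Finset.sum_sub_distrib, ← Finset.sum_mul, hm, one_mul, totalActual, Nat.cast_sum]
  rw [this]
  refine (Finset.abs_sum_le_sum_abs _ _).trans (Finset.sum_le_sum fun i _ => ?_)
  linarith [abs_nonneg (numTokens x i : ℝ)]

lemma exists_le_typeDeviation_of_le_totalDeviation [Nonempty ι] {r q ε : ℝ} (hr : 0 ≤ r)
    {m : ι → ℝ} (hm : ∑ i, m i = 1) {x : State K} (h : ε ≤ totalDeviation r q x) :
    ∃ i, ε / Fintype.card ι ≤ typeDeviation r q (m i) i x := by
  obtain ⟨i, -, hi⟩ := Finset.exists_le_of_sum_le (s := Finset.univ) Finset.univ_nonempty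
    (f := fun _ : ι => ε / Fintype.card ι) (g := fun i => typeDeviation r q (m i) i x) (by
      refine le_trans (le_of_eq ?_) (h.trans (totalDeviation_le_sum hr hm x))
      simp only [Finset.sum_const, Finset.card_univ, nsmul_eq_mul]
      field_simp)
  exact ⟨i, hi⟩

end Deviations

/-! ### Choice of the exponent and passage to the limit -/

section Limit

lemma tendsto_maximal_bound {r : ℕ → ℝ} (hr : Tendsto r atTop atTop) {q T c C δ : ℝ} {M : ℕ}
    (h1 : 0 < M * (q - 1 / 2)) (h2 : 1 - q < M * (q - 1 / 2)) (hδ : 0 < δ) :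
    Tendsto (fun n => ENNReal.ofReal ((C * √(r n) ^ M / c + C * √(r n) ^ M * (T * r n ^ (1 - q))) /
      (δ * r n ^ q) ^ M)) atTop (𝓝 0) := by
  rw [← ENNReal.ofReal_zero]
  refine ENNReal.tendsto_ofReal ?_
  have e1 : Tendsto (fun n => r n ^ (-(M * (q - 1 / 2)))) atTop (𝓝 0) :=
    (tendsto_rpow_neg_atTop h1).comp hr
  have e2 : Tendsto (fun n => r n ^ (-(M * (q - 1 / 2) - (1 - q)))) atTop (𝓝 0) :=
    (tendsto_rpow_neg_atTop (by linarith)).comp hr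
  have e3 := (e1.const_mul (C / c / δ ^ M)).add (e2.const_mul (C * T / δ ^ M))
  rw [mul_zero, mul_zero, add_zero] at e3
  refine e3.congr' ?_
  filter_upwards [hr.eventually_gt_atTop 0] with n hn
  have s1 : √(r n) ^ M = r n ^ ((M : ℝ) * (1 / 2)) := by
    rw [Real.sqrt_eq_rpow, ← Real.rpow_mul_natCast hn.le, mul_comm]
  have s2 : (r n ^ q) ^ M = r n ^ (M * q) := by
    rw [← Real.rpow_mul_natCast hn.le, mul_comm]
  have s3 : -(M * (q - 1 / 2)) = (M : ℝ) * (1 / 2) - M * q := by ring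
  have s4 : -(M * (q - 1 / 2) - (1 - q)) = (M : ℝ) * (1 / 2) + (1 - q) - M * q := by ring
  rw [mul_pow, s1, s2, s3, s4, Real.rpow_sub hn, Real.rpow_sub hn, Real.rpow_add hn]
  have : r n ^ (M * q) ≠ 0 := (Real.rpow_pos_of_pos hn _).ne'
  field_simp

lemma exists_of_le_abs_sSup_valuesUpTo {g : ℝ≥0 → ℝ} {a ε : ℝ} (hε : 0 < ε) (ha : 0 ≤ a)
    (hg : ∀ t, 0 ≤ g t) (h : ε ≤ |sSup (valuesUpTo g a)|) : ∃ t : ℝ≥0, (t : ℝ) ≤ a ∧ ε / 2 ≤ g t := by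
  have h0 : 0 ≤ sSup (valuesUpTo g a) := Real.sSup_nonneg fun _ ⟨t, _, e⟩ => e ▸ hg t
  rw [abs_of_nonneg h0] at h
  obtain ⟨_, ⟨t, ht, rfl⟩, hlt⟩ := exists_lt_of_lt_csSup (s := valuesUpTo g a)
    ⟨g 0, 0, by simpa using ha, rfl⟩ (lt_of_lt_of_le (half_lt_self hε) h)
  exact ⟨t, ht, hlt.le⟩

variable {ι : Type*} [Fintype ι] [DecidableEq ι] {K : Finset (ι → ℕ)}

/-- A deviation that is dominated by all systemic Lyapunov functions is uniformly small over
polynomially long time intervals. -/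
theorem tendstoInDistribution_sSup_of_dominated [Nonempty ι]
    (hK : ∀ k ∈ K, ∀ k' : ι → ℕ, k' ≤ k → k' ∈ K)
    {lam mu : ι → ℝ} {mu0 : ℝ} (hlam : ∀ i, 0 < lam i) (hmu : ∀ i, 0 < mu i) (hmu0 : 0 < mu0)
    {p : ℝ} {r : ℕ → ℝ} (hr_pos : ∀ n, 0 < r n) (hr : Tendsto r atTop atTop)
    {τ : ℕ → TieBreaking K p} {Ω : ℕ → Type*} {mΩ : ∀ n, MeasurableSpace (Ω n)}
    {P : ∀ n, Measure (Ω n)} [∀ n, IsProbabilityMeasure (P n)]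
    {ℱ : ∀ n, Filtration ℝ≥0 (mΩ n)} {X : ∀ n, ℝ≥0 → Ω n → State K}
    (hX : ∀ n, IsMarkovChain (generator lam mu mu0 (r n) (τ n)) (P n) (ℱ n) (X n))
    (hX_stat : ∀ n, IsStationaryProcess (P n) (X n))
    {q T : ℝ} (hq : 1 / 2 < q) (hT : 0 < T) {g : ℝ → State K → ℝ}
    (hg : ∀ r x, 0 < r → 0 ≤ g r x)
    (hdom : ∀ ε > 0, ∃ δ > 0, ∀ n : ℕ, Even n → ∀ κ : ι → ℝ, (∀ j, 1 ≤ κ j) →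
      ∀ r > 0, ∀ x, ε ≤ g r x → (δ * r ^ q) ^ (n + 2) ≤
        systemLyapunov n κ (fun j => lam j / mu j * r) (numActual x) (numTokens x)) :
    TendstoInDistribution
      (fun n ω => sSup (valuesUpTo (fun t => g (r n) (X n t ω)) (T * r n ^ (1 - q))))
      atTop (fun _ : Unit => (0 : ℝ)) P (Measure.dirac ()) := by
  have ha : ∀ n, 0 ≤ T * r n ^ (1 - q) := fun n =>
    mul_nonneg hT.le (Real.rpow_nonneg (hr_pos n).le _)
  refine tendstoInDistribution_zero
    (fun n => (hX n).measurable_sSup_valuesUpTo (g (r n)) (ha n)) fun ε hε => ?_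
  obtain ⟨δ, hδ, hdom⟩ := hdom (ε / 2) (half_pos hε)
  have hq' : 0 < q - 1 / 2 := by linarith
  -- The power must be high enough for the gain `M * (q - 1 / 2)` to beat the exponent `1 - q` of
  -- the window length.
  obtain ⟨k, hk⟩ := exists_nat_gt ((1 - q) / (q - 1 / 2))
  rw [div_lt_iff₀ hq'] at hk
  have hn : Even (2 * k) := even_two_mul k
  obtain ⟨κ, c, C, hκ, hc, hC, hV⟩ := exists_isLyapunov hK hlam hmu hmu0 hn
  have hM : (0 : ℝ) < (2 * k + 2 : ℕ) := by positivity
  refine tendsto_of_tendsto_of_tendsto_of_le_of_le' tendsto_const_nhds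
    (tendsto_maximal_bound (T := T) (c := c) (C := C) (M := 2 * k + 2) hr (mul_pos hM hq') ?_ hδ)
    (.of_forall fun _ => zero_le) ?_
  · have : (k : ℝ) * (q - 1 / 2) ≤ (2 * k + 2 : ℕ) * (q - 1 / 2) := by
      gcongr
      exact_mod_cast (by omega : k ≤ 2 * k + 2)
    linarith
  · filter_upwards [hr.eventually_ge_atTop 1] with n hn1
    have hδr : 0 < (δ * r n ^ q) ^ (2 * k + 2) :=
      pow_pos (mul_pos hδ (Real.rpow_pos_of_pos (hr_pos n) q)) _
    have hmax := (hV (r n) hn1 p (τ n)).measure_exists_le hc (by positivity) (hX n) (hX_stat n)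
      hδr ⟨_, ha n⟩
    refine (measure_mono fun ω hω => ?_).trans hmax
    obtain ⟨t, ht, hgt⟩ := exists_of_le_abs_sSup_valuesUpTo hε (ha n)
      (fun t => hg _ (X n t ω) (hr_pos n)) hω
    exact ⟨t, ht, hdom _ hn κ hκ (r n) (hr_pos n) _ hgt⟩

end Limit

end PackingSystem

theorem mainTheorem4 {ι : Type*} [Fintype ι] [DecidableEq ι]
    (K : Finset (ι → ℕ))
    (hK_mono : ∀ k ∈ K, ∀ k' : ι → ℕ, k' ≤ k → k' ∈ K)
    (hK_unit : ∀ i, unitVec i ∈ K)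
    (lam mu : ι → ℝ) (mu0 : ℝ)
    (hlam : ∀ i, 0 < lam i) (hmu : ∀ i, 0 < mu i) (hmu0 : 0 < mu0)
    (hrho : ∑ i, lam i / mu i = 1)
    (p : ℝ) (hp : p ∈ Set.Ioo (1 / 2 : ℝ) 1)
    (r : ℕ → ℝ) (hr_pos : ∀ n, 0 < r n) (hr : Tendsto r atTop atTop)
    (τ : ℕ → TieBreaking K p)
    {Ω : ℕ → Type*} {mΩ : ∀ n, MeasurableSpace (Ω n)}
    (P : ∀ n, Measure (Ω n)) [∀ n, IsProbabilityMeasure (P n)]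
    (ℱ : ∀ n, Filtration ℝ≥0 (mΩ n))
    (X : ∀ n, ℝ≥0 → Ω n → State K)
    (hX : ∀ n, IsMarkovChain (generator lam mu mu0 (r n) (τ n)) (P n) (ℱ n) (X n))
    (hX_stat : ∀ n, IsStationaryProcess (P n) (X n))
    (q T : ℝ) (hq : 1 / 2 < q) (hT : 0 < T) :
    (∀ i,
      (∀ n ω, BddAbove (valuesUpTo
        (fun t => typeDeviation (r n) q (lam i / mu i) i (X n t ω)) (T * r n ^ (1 - q)))) ∧
      TendstoInDistribution
        (fun n ω => sSup (valuesUpTo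
          (fun t => typeDeviation (r n) q (lam i / mu i) i (X n t ω)) (T * r n ^ (1 - q))))
        atTop (fun _ : Unit => (0 : ℝ)) P (Measure.dirac ())) ∧
    (∀ n ω, BddAbove (valuesUpTo
      (fun t => totalDeviation (r n) q (X n t ω)) (T * r n ^ (1 - q)))) ∧
    TendstoInDistribution
      (fun n ω => sSup (valuesUpTo
        (fun t => totalDeviation (r n) q (X n t ω)) (T * r n ^ (1 - q))))
      atTop (fun _ : Unit => (0 : ℝ)) P (Measure.dirac ()) := by
  -- With no types the loads would sum to 0 instead of 1.
  have hne : Nonempty ι := by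
    by_contra h
    rw [not_nonempty_iff] at h
    simp at hrho
  have ha : ∀ n, 0 ≤ T * r n ^ (1 - q) := fun n =>
    mul_nonneg hT.le (Real.rpow_nonneg (hr_pos n).le _)
  refine ⟨fun i => ⟨fun n ω => ?_, ?_⟩, fun n ω => ?_, ?_⟩
  · exact bddAbove_valuesUpTo ((hX n).right_continuous ω) ((hX n).left_limits ω)
      (typeDeviation (r n) q (lam i / mu i) i) (ha n)
  · refine tendstoInDistribution_sSup_of_dominated hK_mono hlam hmu hmu0 hr_pos hr hX hX_stat hq hT
      (g := fun r => typeDeviation r q (lam i / mu i) i)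
      (fun r x hr => typeDeviation_nonneg hr.le _ _ _ _) fun ε hε =>
        ⟨ε / 2, half_pos hε, fun n hn κ hκ r hr x h => ?_⟩
    exact pow_le_systemLyapunov_of_le_typeDeviation hn hκ hr hε.le (m := fun i => lam i / mu i) h
  · exact bddAbove_valuesUpTo ((hX n).right_continuous ω) ((hX n).left_limits ω)
      (totalDeviation (r n) q) (ha n)
  · refine tendstoInDistribution_sSup_of_dominated hK_mono hlam hmu hmu0 hr_pos hr hX hX_stat hq hT
      (g := fun r => totalDeviation r q)
      (fun r x hr => mul_nonneg (Real.rpow_nonneg hr.le _) (abs_nonneg _)) fun ε hε =>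
        -- By pigeonhole some type carries a share `1 / Fintype.card ι` of the total deviation; the
        -- 1/2 comes from the 1-norm.
        ⟨ε / Fintype.card ι / 2, by positivity, fun n hn κ hκ r hr x h => ?_⟩
    obtain ⟨i, hi⟩ := exists_le_typeDeviation_of_le_totalDeviation hr.le hrho h
    exact pow_le_systemLyapunov_of_le_typeDeviation hn hκ hr (by positivity)
      (m := fun i => lam i / mu i) hi
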